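/- \textbf{Setting.} Let $\mathcal H$ be the Butcher--Connes--Kreimer Hopf algebra: the free commutative $\mathbb R$-algebra on the non-empty unlabelled non-planar rooted trees, with unit the empty forest (= empty tree) $\emptyset$, counit $\varepsilon$ ($\varepsilon(\emptyset)=1$, $\varepsilon(\tau)=0$ for non-empty trees $\tau$), coproduct $\Delta(\tau)=\sum_c P_c(\tau)\otimes R_c(\tau)$ over the admissible cuts $c$ of the tree $\tau$ (the empty cut and the total cut included; $R_c(\tau)$ is the component of the root and $P_c(\tau)$ the forest of the remaining components), extended multiplicatively, and antipode $S(\tau)=\sum_{c\subseteq E}(-1)^{|c|+1}\tau^c$ over all sets $c$ of edges of $\tau=(V,E)$, where $\tau^c=(V,E\setminus c)$, extended multiplicatively. A character is an algebra homomorphism $\psi:\mathcal H\to\mathbb R$; characters form a group under $\varphi_1*\varphi_2=\mu_{\mathbb R}\circ(\varphi_1\otimes\varphi_2)\circ\Delta$ with identity $\varepsilon$. Write $|\tau|$ for the number of nodes of $\tau$, and let $\bar\psi$ be the character with $\bar\psi(\tau)=(-1)^{|\tau|}\psi(\tau)$. The character $\psi$ is \emph{odd} if $\bar\psi=\psi^{-1}$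 in this group. A (formal one-step) method $\Psi$ assigns to each $N\ge 0$ and each smooth vector field $f:\mathbb R^N\to\mathbb R^N$ a formal power series $\Psi_h=\Psi_{h,f}$ in $h$ whose coefficients are maps $\mathbb R^N\to\mathbb R^N$; such series are composed by formal Taylor expansion. The B-series method with character $\psi$ is $$\Psi_{h,f}(y)=B_h(\psi,y)=\sum_\tau \frac{h^{|\tau|}}{\sigma(\tau)}\,\psi(\tau)\,F(\tau)(y),$$ summed over all rooted trees including $\emptyset$, where $\sigma(\tau)$ is the order of the symmetry group of $\tau$ and $F(\tau)$ is the elementary differential: $F(\emptyset)(y)=y$ and $F([\tau_1,\dots,\tau_m])(y)=f^{(m)}(y)(F(\tau_1)(y),\dots,F(\tau_m)(y))$. The adjoint of a method $\Psi$ is $\Psi^*_h=\Psi_{-h}^{-1}$, the two-sided inverse for composition of $\Psi_{-h}$ (for all $N$ and $f$), and $\Psi$ is symmetric if $\Psi=\Psi^*$. \textbf{Theorem.} Let $\Psi$ be the B-series method with character $\psi$. Then $\Psi$ has exactly one adjoint method $\Psi^*$, and $\Psi^*$ is again a B-series method. If $\psi^*$ is a character whose B-series method is $\Psi^*$, then $$\psi^*(\tau)=(-1)^{|\tau|}\,\psi(S\tau)\qquad\text{for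 every rooted tree }\tau,$$ that is, $\psi^*=\overline{\psi\circ S}$ on $\mathcal H$. Consequently, $\Psi$ is symmetric if and only if $\psi$ is odd, and also if and only if $\psi(\tau)=(-1)^{|\tau|}\psi(S\tau)$ for every rooted tree $\tau$. -/

import Mathlib

open scoped TensorProduct ContDiff

noncomputable section

namespace BCK

/-! ### Non-planar rooted trees -/

/-- Finite multisets form a quotient of the polynomial functor `X ↦ Σ n, (Fin n → X)`. -/
instance multisetQPF : QPF Multiset where
  map := @Multiset.map
  P := ⟨ℕ, Fin⟩
  abs := fun p => Multiset.ofList (List.ofFn p.2)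
  repr := fun s => ⟨s.toList.length, s.toList.get⟩
  abs_repr := by
    intro α s
    have h : List.ofFn s.toList.get = s.toList := List.ofFn_get _
    exact (congrArg Multiset.ofList h).trans s.coe_toList
  abs_map := by
    rintro α β f ⟨n, v⟩
    simp [PFunctor.map, List.map_ofFn]

/-- Non-empty, unlabelled, non-planar rooted trees: the initial algebra of the finite multiset
functor, i.e. a tree is exactly the same thing as the finite multiset of the subtrees that are
attached to its root (see `RTree.node`, `RTree.children` and `RTree.ind`). -/
def RTree : Type := QPF.Fix Multiset

namespace RTree

/-- `node {τ₁, …, τₖ} = [τ₁, …, τₖ]`: join the roots of `τ₁, …, τₖ` to a new root. -/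
def node (s : Multiset RTree) : RTree := QPF.Fix.mk (F := Multiset) s

/-- The multiset of the subtrees attached to the root. -/
def children (t : RTree) : Multiset RTree := QPF.Fix.dest (F := Multiset) t

@[simp] theorem node_children (t : RTree) : node (children t) = t :=
  QPF.Fix.mk_dest (F := Multiset) t

@[simp] theorem children_node (s : Multiset RTree) : children (node s) = s :=
  QPF.Fix.dest_mk (F := Multiset) s

theorem node_injective : Function.Injective node :=
  Function.LeftInverse.injective children_node

/-- Structural induction on trees. -/
theorem ind {p : RTree → Prop} (h : ∀ s : Multiset RTree, (∀ t ∈ s, p t) → p (node s))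
    (t : RTree) : p t := by
  refine QPF.Fix.ind (F := Multiset) p ?_ t
  intro s hs
  refine h s ?_
  obtain ⟨u, hu⟩ := hs
  intro t ht
  have hu' : Multiset.map Subtype.val u = s := hu
  subst hu'
  obtain ⟨x, -, hx⟩ := Multiset.mem_map.1 ht
  exact hx ▸ x.2

/-- Recursion with values in the pairs (the tree itself, the value on it). -/
def paraAux {α : Type} (g : Multiset (RTree × α) → α) : RTree → RTree × α :=
  QPF.Fix.rec (F := Multiset) (fun s => (node (s.map Prod.fst), g s))

/-- Structural recursion on trees: `para g` is the function `φ` that satisfies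
`φ (node s) = g {(t, φ t) | t ∈ s}`, see `para_node`. -/
def para {α : Type} (g : Multiset (RTree × α) → α) (t : RTree) : α := (paraAux g t).2

theorem paraAux_node {α : Type} (g : Multiset (RTree × α) → α) (s : Multiset RTree) :
    paraAux g (node s) =
      (node ((s.map (paraAux g)).map Prod.fst), g (s.map (paraAux g))) :=
  QPF.Fix.rec_eq (F := Multiset)
    (fun s : Multiset (RTree × α) => (node (s.map Prod.fst), g s)) s

theorem paraAux_fst {α : Type} (g : Multiset (RTree × α) → α) (t : RTree) :
    (paraAux g t).1 = t := by
  induction t using RTree.ind with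
  | h s ih =>
    rw [paraAux_node]
    simp only [Multiset.map_map, Function.comp_apply]
    rw [Multiset.map_congr rfl ih, Multiset.map_id']

theorem para_node {α : Type} (g : Multiset (RTree × α) → α) (s : Multiset RTree) :
    para g (node s) = g (s.map fun t => (t, para g t)) := by
  rw [para, paraAux_node]
  refine congrArg g (Multiset.map_congr rfl fun t _ => ?_)
  exact Prod.ext (paraAux_fst g t) rfl

/-- `|τ|`, the number of nodes of `τ`. -/
def order : RTree → ℕ := para fun s => 1 + (s.map Prod.snd).sum

theorem order_node (s : Multiset RTree) : order (node s) = 1 + (s.map order).sum := by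
  rw [order, para_node, Multiset.map_map]
  rfl

open Classical in
/-- The symmetry coefficient `σ(τ)`, with
`σ([τ₁ ^ k₁, …, τₘ ^ kₘ]) = ∏ kᵢ! σ(τᵢ) ^ kᵢ` for distinct `τ₁, …, τₘ`. -/
def symmetryFactor : RTree → ℕ := para fun s =>
  (∏ t ∈ (s.map Prod.fst).toFinset, ((s.map Prod.fst).count t).factorial) * (s.map Prod.snd).prod

open Classical in
theorem symmetryFactor_node (s : Multiset RTree) :
    symmetryFactor (node s) = (∏ t ∈ s.toFinset, (s.count t).factorial) * (s.map symmetryFactor).prod := by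
  rw [symmetryFactor, para_node]
  simp only [Multiset.map_map, Function.comp_def, Multiset.map_id']

theorem order_pos (t : RTree) : 0 < order t := by
  rw [← node_children t, order_node]
  omega

theorem finite_order_le (n : ℕ) : {t : RTree | order t ≤ n}.Finite := by
  classical
  induction n with
  | zero =>
    refine Set.Finite.subset Set.finite_empty fun t ht => ?_
    have := order_pos t
    simp only [Set.mem_ofPred_eq] at ht
    omega
  | succ n ih =>
    have key : ∀ s : Multiset RTree, s.card ≤ (s.map order).sum := by
      intro s
      have h := Multiset.card_nsmul_le_sum (s := s.map order) (a := 1) (by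
        intro x hx
        obtain ⟨t, -, rfl⟩ := Multiset.mem_map.1 hx
        exact order_pos t)
      simpa using h
    have hfin : (⋃ k ∈ Finset.range (n + 1),
        (fun m : Sym RTree k => node m.1) '' (ih.toFinset.sym k : Set (Sym RTree k))).Finite :=
      Set.Finite.biUnion (Finset.finite_toSet _) fun k _ => (Finset.finite_toSet _).image _
    refine hfin.subset fun t ht => ?_
    obtain ⟨s, rfl⟩ : ∃ s, node s = t := ⟨children t, node_children t⟩
    simp only [Set.mem_ofPred_eq, order_node] at ht
    simp only [Set.mem_iUnion]
    refine ⟨s.card, Finset.mem_range.2 ?_, ⟨s, rfl⟩, ?_, rfl⟩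
    · have := key s
      omega
    · refine Finset.mem_coe.2 (Finset.mem_sym_iff.2 ?_)
      intro t hts
      have hts' : t ∈ s := hts
      have h1 : order t ≤ (s.map order).sum :=
        Multiset.single_le_sum (fun _ _ => Nat.zero_le _) _ (Multiset.mem_map_of_mem _ hts')
      rw [Set.Finite.mem_toFinset, Set.mem_ofPred_eq]
      omega

theorem finite_order_eq (n : ℕ) : {t : RTree | order t = n}.Finite :=
  (finite_order_le n).subset fun _ ht => le_of_eq ht

/-- The finite set of all trees with `n` nodes. -/
def ofOrder (n : ℕ) : Finset RTree := (finite_order_eq n).toFinset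

@[simp] theorem mem_ofOrder {n : ℕ} {t : RTree} : t ∈ ofOrder n ↔ order t = n := by
  simp [ofOrder]

/-- All cuts of a tree, i.e. all subsets `c` of its edge set, listed (with multiplicity, one entry
per subset of edges) as the pairs `(R_c(τ), P_c(τ))`: `R_c(τ)` is the connected component of the
root of `τ` once the edges in `c` are removed, and `P_c(τ)` is the multiset of the other connected
components. So `|c|` is the cardinality of `P_c(τ)`.

A cut of `node s` is an independent choice, for each subtree `t ∈ s`, of a cut of `t` and of whether
the edge from the root to `t` is removed; if it is not, the component of the root of `t` becomes a
subtree attached to the root of `R_c`, and if it is, that component becomes a member of `P_c`. -/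
def cuts : RTree → Multiset (RTree × Multiset RTree) := para fun s =>
  (Multiset.Sections (s.map fun tc =>
    tc.2.map (fun c => (({c.1} : Multiset RTree), c.2)) +
      tc.2.map (fun c => ((0 : Multiset RTree), {c.1} + c.2)))).map
    fun choice => (node (choice.map Prod.fst).sum, (choice.map Prod.snd).sum)

theorem cuts_node (s : Multiset RTree) :
    cuts (node s) =
      (Multiset.Sections (s.map fun t =>
        (cuts t).map (fun c => (({c.1} : Multiset RTree), c.2)) +
          (cuts t).map (fun c => ((0 : Multiset RTree), {c.1} + c.2)))).map
        fun choice => (node (choice.map Prod.fst).sum, (choice.map Prod.snd).sum) := by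
  rw [cuts, para_node, Multiset.map_map]
  rfl

/-- All admissible cuts of a tree other than the total cut, i.e. all sets of edges that meet every
path from the root at most once, again listed as the pairs `(R_c(τ), P_c(τ))`.

An admissible cut of `node s` is an independent choice, for each subtree `t ∈ s`, of either removing
the edge from the root to `t` and no edge of `t`, or keeping this edge and taking an admissible cut
of `t`. The empty cut is included. -/
def admCuts : RTree → Multiset (RTree × Multiset RTree) := para fun s =>
  (Multiset.Sections (s.map fun tc =>
    tc.2.map (fun c => (({c.1} : Multiset RTree), c.2)) +
      {((0 : Multiset RTree), ({tc.1} : Multiset RTree))})).map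
    fun choice => (node (choice.map Prod.fst).sum, (choice.map Prod.snd).sum)

theorem admCuts_node (s : Multiset RTree) :
    admCuts (node s) =
      (Multiset.Sections (s.map fun t =>
        (admCuts t).map (fun c => (({c.1} : Multiset RTree), c.2)) +
          {((0 : Multiset RTree), ({t} : Multiset RTree))})).map
        fun choice => (node (choice.map Prod.fst).sum, (choice.map Prod.snd).sum) := by
  rw [admCuts, para_node, Multiset.map_map]
  rfl

end RTree

/-! ### The Butcher–Connes–Kreimer Hopf algebra -/

/-- The underlying algebra: the free commutative `ℝ`-algebra on the non-empty rooted trees. Its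
monomials are the forests, and the empty forest (the empty tree) is the unit `1`. -/
abbrev H : Type := MvPolynomial RTree ℝ

/-- A tree as an element of `H`. -/
def tree (t : RTree) : H := MvPolynomial.X t

/-- The forest with the given trees, as an element of `H`. -/
def forest (s : Multiset RTree) : H := (s.map tree).prod

/-- The counit: `1` on the empty forest and `0` on all non-empty trees. -/
def counit : H →ₐ[ℝ] ℝ := MvPolynomial.aeval fun _ => 0

/-- The coproduct, `Δ(τ) = ∑ P_c(τ) ⊗ R_c(τ)` over the admissible cuts of the tree `τ`, of which the
total cut contributes `τ ⊗ 1`; it is extended to `H` as an algebra homomorphism. -/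
def coproduct : H →ₐ[ℝ] H ⊗[ℝ] H := MvPolynomial.aeval fun t =>
  tree t ⊗ₜ[ℝ] (1 : H) + (t.admCuts.map fun c => forest c.2 ⊗ₜ[ℝ] tree c.1).sum

/-- The antipode, `S(τ) = ∑ (-1) ^ (|c| + 1) τ^c` over all cuts `c ⊆ E` of the tree `τ`, where the
forest `τ^c = (V, E \ c)` consists of `R_c(τ)` and `P_c(τ)`; it is extended to `H` as an algebra
homomorphism. -/
def antipode : H →ₐ[ℝ] H := MvPolynomial.aeval fun t =>
  (t.cuts.map fun c => (-1 : H) ^ (c.2.card + 1) * (tree c.1 * forest c.2)).sum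

/-- The characters of `H`, i.e. the elements of the Butcher group. -/
abbrev Character : Type := H →ₐ[ℝ] ℝ

/-- The convolution product `μ ∘ (φ₁ ⊗ φ₂) ∘ Δ` of two characters. -/
def conv (φ₁ φ₂ : Character) : Character :=
  (Algebra.TensorProduct.lmul' ℝ).comp ((Algebra.TensorProduct.map φ₁ φ₂).comp coproduct)

/-- The canonical involution of `H`, with `τ ↦ (-1) ^ |τ| τ` for all trees (hence forests) `τ`. -/
def involution : H →ₐ[ℝ] H := MvPolynomial.aeval fun t => (-1 : H) ^ t.order * tree t

/-- The character `ζ̄`, with `ζ̄(τ) = (-1) ^ |τ| ζ(τ)`. -/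
def bar (ζ : Character) : Character := ζ.comp involution

/-- A character `ζ` is odd if `ζ̄` is the inverse of `ζ` for the convolution product. -/
def IsOdd (ζ : Character) : Prop := conv (bar ζ) ζ = counit ∧ conv ζ (bar ζ) = counit

/-! ### Formal one-step methods and B-series -/

/-- A formal power series `∑ hⁿ cₙ` in the step size `h` whose coefficients are maps
`ℝᴺ → ℝᴺ`. -/
abbrev FormalMap (N : ℕ) : Type := ℕ → (Fin N → ℝ) → (Fin N → ℝ)

namespace FormalMap

variable {N : ℕ}

/-- The identity map `y ↦ y`. -/
def id : FormalMap N := fun n y => if n = 0 then y else 0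

/-- Replace `h` by `-h`. -/
def neg (Ψ : FormalMap N) : FormalMap N := fun n y => (-1 : ℝ) ^ n • Ψ n y

/-- The coefficient of `hⁿ` in the formal Taylor expansion of `g(Ψ_h(y))` about `Ψ₀(y)`:
`∑ 1/m! g⁽ᵐ⁾(Ψ₀(y))(Ψ_{k₁}(y), …, Ψ_{kₘ}(y))`, summed over all `m` and all
`k₁, …, kₘ ≥ 1` with `k₁ + ⋯ + kₘ = n`. -/
def substCoeff (g : (Fin N → ℝ) → (Fin N → ℝ)) (Ψ : FormalMap N) (n : ℕ) (y : Fin N → ℝ) :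
    Fin N → ℝ :=
  ∑ c : Composition n, ((c.length.factorial : ℝ)⁻¹) •
    iteratedFDeriv ℝ c.length g (Ψ 0 y) (fun i => Ψ (c.blocksFun i) y)

/-- The composition `Φ_h ∘ Ψ_h` as a formal power series: `Φ_h(Ψ_h(y)) = ∑ hⁱ Φᵢ(Ψ_h(y))`. -/
def comp (Φ Ψ : FormalMap N) : FormalMap N := fun n y =>
  ∑ p ∈ Finset.HasAntidiagonal.antidiagonal n, substCoeff (Φ p.1) Ψ p.2 y

end FormalMap

/-- Smooth vector fields on `ℝᴺ`. -/
abbrev SmoothField (N : ℕ) : Type := {f : (Fin N → ℝ) → (Fin N → ℝ) // ContDiff ℝ ∞ f}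

/-- A formal one-step method: a formal power series in the step size for each smooth vector field
in each dimension. -/
abbrev Method : Type := ∀ N : ℕ, SmoothField N → FormalMap N

/-- The elementary differentials
`F([τ₁, …, τₘ])(y) = f⁽ᵐ⁾(y)(F(τ₁)(y), …, F(τₘ)(y))`. As the derivatives of a smooth `f`
are symmetric, the order in which the subtrees are listed does not matter, see
`elementaryDifferential_node`. -/
def elementaryDifferential {N : ℕ} (f : (Fin N → ℝ) → (Fin N → ℝ)) :
    RTree → (Fin N → ℝ) → (Fin N → ℝ) :=
  RTree.para fun s y =>
    iteratedFDeriv ℝ (s.map Prod.snd).toList.length f y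
      (fun i => (s.map Prod.snd).toList.get i y)

theorem iteratedFDeriv_perm {N : ℕ} {f : (Fin N → ℝ) → (Fin N → ℝ)} (hf : ContDiff ℝ ∞ f)
    {l l' : List (Fin N → ℝ)} (h : l.Perm l') (y : Fin N → ℝ) :
    iteratedFDeriv ℝ l.length f y l.get = iteratedFDeriv ℝ l'.length f y l'.get := by
  have smooth : ∀ l : List (Fin N → ℝ),
      ContDiff ℝ ∞ (fun z => iteratedFDeriv ℝ l.length f z l.get) := fun l =>
    (ContinuousMultilinearMap.apply ℝ (fun _ : Fin l.length => Fin N → ℝ) (Fin N → ℝ)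
      l.get).contDiff.comp
      (hf.iteratedFDeriv_right (m := ∞) (by norm_cast))
  have cons : ∀ (a : Fin N → ℝ) (l : List (Fin N → ℝ)) (z : Fin N → ℝ),
      iteratedFDeriv ℝ (a :: l).length f z (a :: l).get =
        fderiv ℝ (fun z => iteratedFDeriv ℝ l.length f z l.get) z a := by
    intro a l z
    have hd : DifferentiableAt ℝ (iteratedFDeriv ℝ l.length f) z :=
      (hf.differentiable_iteratedFDeriv (by exact_mod_cast WithTop.coe_lt_top _)) z
    rw [fderiv_continuousMultilinear_apply_const_apply hd]
    rfl
  induction h generalizing y with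
  | nil => rfl
  | cons a _ ih => rw [cons, cons, funext ih]
  | swap a b l =>
    have key : ∀ a b : Fin N → ℝ,
        iteratedFDeriv ℝ (a :: b :: l).length f y (a :: b :: l).get =
          fderiv ℝ (fderiv ℝ fun z => iteratedFDeriv ℝ l.length f z l.get) y a b := by
      intro a b
      have hd : DifferentiableAt ℝ
          (fderiv ℝ fun z => iteratedFDeriv ℝ l.length f z l.get) y :=
        ((smooth l).fderiv_right (m := 1) (by norm_cast)).differentiable (by simp) y
      rw [cons, funext (cons b l), fderiv_clm_apply hd (differentiableAt_const b)]
      simp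
    rw [key, key]
    exact ((smooth l).contDiffAt.isSymmSndFDerivAt (by
      simpa using (WithTop.coe_le_coe.2 (le_top : (2 : ℕ∞) ≤ ⊤)))).eq b a
  | trans _ _ ih₁ ih₂ => rw [ih₁, ih₂]

theorem elementaryDifferential_node {N : ℕ} {f : (Fin N → ℝ) → (Fin N → ℝ)}
    (hf : ContDiff ℝ ∞ f) (l : List RTree) (y : Fin N → ℝ) :
    elementaryDifferential f (RTree.node l) y =
      iteratedFDeriv ℝ l.length f y (fun i => elementaryDifferential f (l.get i) y) := by
  have get_map : ∀ {α : Type} (l : List α) (g : α → (Fin N → ℝ)),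
      iteratedFDeriv ℝ (l.map g).length f y (l.map g).get =
        iteratedFDeriv ℝ l.length f y (fun i => g (l.get i)) := by
    intro α l g
    have : ∀ (n : ℕ) (h : n = l.length) (v : Fin n → (Fin N → ℝ)),
        (∀ i, v i = g (l.get (Fin.cast h i))) →
        iteratedFDeriv ℝ n f y v = iteratedFDeriv ℝ l.length f y (fun i => g (l.get i)) := by
      rintro n rfl v hv
      exact congrArg _ (funext hv)
    exact this _ (by simp) _ (by simp)
  rw [elementaryDifferential, RTree.para_node, ← elementaryDifferential]
  refine (get_map (Multiset.toList _) (fun g : (Fin N → ℝ) → (Fin N → ℝ) => g y)).symm.trans (Eq.trans ?_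
    (get_map l fun t => elementaryDifferential f t y))
  refine iteratedFDeriv_perm hf ?_ y
  rw [← Multiset.coe_eq_coe, ← Multiset.map_coe, Multiset.coe_toList, Multiset.map_map,
    ← Multiset.map_coe, Multiset.map_map]
  rfl

/-- The B-series method of the character `φ`, i.e. the formal power series
`B_h(φ, y) = ∑ h ^ |τ| / σ(τ) φ(τ) F(τ)(y)` over all rooted trees `τ`. The coefficient of `h⁰`
is the contribution `φ(1) F(∅)(y) = y` of the empty tree. -/
def bSeries (φ : Character) : Method := fun _ f n y =>
  if n = 0 then y
  else ∑ t ∈ RTree.ofOrder n, (φ (tree t) / (t.symmetryFactor : ℝ)) • elementaryDifferential f.1 t y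

/-- `Φ` is the adjoint method of `Ψ`: `Φ_h = (Ψ_{-h})⁻¹`. -/
def IsAdjoint (Ψ Φ : Method) : Prop := ∀ (N : ℕ) (f : SmoothField N),
  (Φ N f).comp (Ψ N f).neg = FormalMap.id ∧ (Ψ N f).neg.comp (Φ N f) = FormalMap.id

/-- A method is symmetric if it is its own adjoint. -/
def IsSymmetric (Ψ : Method) : Prop := IsAdjoint Ψ Ψ

end BCK

end

noncomputable section

namespace BCK

/-! ### The grafting operator and the group of characters -/

/-! Everything reduces to three facts: composing B-series multiplies characters, `B(φ₂) ∘ B(φ₁) =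
B(φ₁ * φ₂)` (`bSeries_comp`); a character is determined by its B-series (`bSeries_injective`); and
`ψ ∘ S` is the two-sided convolution inverse of `ψ`. Since `h ↦ -h` replaces `ψ` by `bar ψ`, a
B-series is adjoint to that of `ψ` exactly when its character is the inverse of `bar ψ`, which is
`(bar ψ) ∘ S = bar (ψ ∘ S)`. Uniqueness among all methods follows by right cancellation, coefficient
by coefficient (`comp_right_cancel`). The symmetry criteria are the case of equal characters.

The algebra rests on the grafting map `graft` and on `translate φ = (φ ⊗ id) ∘ Δ`, which obey the
cocycle identity `translate_graft`. Coassociativity and the unit laws follow by induction on trees.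
For the antipode, the signed sum over all cuts satisfies the same recursion as the sum over
admissible cuts weighted by `ψ ∘ S` (`signedTrunk_eq_trunk`).

For the composition law, the step size becomes a nilpotent `ε` in the truncated polynomial ring.
Taylor expansion along the B-series of `φ` is then an algebra homomorphism `T` from smooth
functions, and induction on `u` expands `ε ^ |u| T(F(u))` over trees, with the coefficient of `u` in
`trunk φ t` as its essential weight (`pow_order_mul_taylor`). Algebra and analysis meet in
`taylorCoeff_node`.

For injectivity, a polynomial vector field with coordinates indexed by trees has elementary
differentials at the origin that are multiples of distinct basis vectors. -/

theorem sum_sections_prod {α R : Type*} [CommSemiring R] (S : Multiset (Multiset α)) (w : α → R) :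
    (S.Sections.map fun c => (c.map w).prod).sum = (S.map fun m => (m.map w).sum).prod := by
  induction S using Multiset.induction_on with
  | empty => simp
  | cons m S ih =>
    rw [Multiset.sections_cons, Multiset.map_bind, Multiset.sum_bind, Multiset.map_cons,
      Multiset.prod_cons, ← ih, ← Multiset.sum_map_mul_right]
    refine congrArg Multiset.sum (Multiset.map_congr rfl fun a _ => ?_)
    simp [Multiset.map_map, Multiset.sum_map_mul_left]

@[simp] theorem forest_zero : forest 0 = 1 := by simp [forest]

@[simp] theorem forest_add (s t : Multiset RTree) : forest (s + t) = forest s * forest t := by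
  simp [forest]

@[simp] theorem forest_cons (t : RTree) (s : Multiset RTree) :
    forest (t ::ₘ s) = tree t * forest s := by
  simp [forest]

@[simp] theorem forest_singleton (t : RTree) : forest {t} = tree t := by simp [forest]

open Classical in
theorem forest_eq_monomial (s : Multiset RTree) :
    forest s = MvPolynomial.monomial (Multiset.toFinsupp s) 1 := by
  induction s using Multiset.induction_on with
  | empty => simp
  | cons t s ih =>
    rw [forest_cons, ih, ← Multiset.singleton_add, map_add, tree, MvPolynomial.X,
      MvPolynomial.monomial_mul, Multiset.toFinsupp_singleton, one_mul]

/-- The grafting operator: `forest s ↦ tree (node s)`. -/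
def graft : H →ₗ[ℝ] H :=
  (MvPolynomial.basisMonomials RTree ℝ).constr ℝ fun m => tree (RTree.node (Finsupp.toMultiset m))

theorem graft_monomial (m : RTree →₀ ℕ) :
    graft (MvPolynomial.monomial m 1) = tree (RTree.node (Finsupp.toMultiset m)) := by
  have := (MvPolynomial.basisMonomials RTree ℝ).constr_basis ℝ
    (fun m => tree (RTree.node (Finsupp.toMultiset m))) m
  rwa [MvPolynomial.coe_basisMonomials] at this

@[simp] theorem graft_forest (s : Multiset RTree) : graft (forest s) = tree (RTree.node s) := by
  classical
  rw [forest_eq_monomial, graft_monomial, Multiset.toFinsupp_toMultiset]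

/-- Algebra homomorphisms from `H` that agree on trees are equal. -/
theorem algHom_ext_tree {R : Type*} [CommSemiring R] [Algebra ℝ R] {φ ψ : H →ₐ[ℝ] R}
    (h : ∀ t, φ (tree t) = ψ (tree t)) : φ = ψ :=
  MvPolynomial.algHom_ext h

theorem algHom_forest {R : Type*} [CommSemiring R] [Algebra ℝ R] (φ : H →ₐ[ℝ] R)
    (s : Multiset RTree) : φ (forest s) = (s.map fun t => φ (tree t)).prod := by
  rw [forest, map_multiset_prod, Multiset.map_map]
  rfl

/-- `∑ φ(P_c(τ)) R_c(τ)` over the admissible cuts other than the total cut. -/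
def trunk (φ : Character) (t : RTree) : H :=
  (t.admCuts.map fun c => φ (forest c.2) • tree c.1).sum

/-- The algebra homomorphism `(φ ⊗ id) ∘ Δ`. -/
def translate (φ : Character) : H →ₐ[ℝ] H :=
  MvPolynomial.aeval fun t => MvPolynomial.C (φ (tree t)) + trunk φ t

theorem translate_tree (φ : Character) (t : RTree) :
    translate φ (tree t) = MvPolynomial.C (φ (tree t)) + trunk φ t := by
  simp [translate, tree]

/-- A sum over independent choices for the subtrees is a product. -/
theorem sum_choices (g : Multiset RTree → ℝ) (hg0 : g 0 = 1) (hg : ∀ a b, g (a + b) = g a * g b)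
    (S : Multiset (Multiset (Multiset RTree × Multiset RTree))) :
    (S.Sections.map fun c => g (c.map Prod.snd).sum • tree (RTree.node (c.map Prod.fst).sum)).sum =
      graft (S.map fun m => (m.map fun p => g p.2 • forest p.1).sum).prod := by
  rw [← sum_sections_prod, map_multiset_sum, Multiset.map_map]
  refine congrArg Multiset.sum (Multiset.map_congr rfl fun c _ => ?_)
  have : (c.map fun p : Multiset RTree × Multiset RTree => g p.2 • forest p.1).prod =
      g (c.map Prod.snd).sum • forest (c.map Prod.fst).sum := by
    clear * - hg0 hg
    induction c using Multiset.induction_on with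
    | empty => simp [hg0]
    | cons a c ih => simp [ih, hg, smul_smul, mul_comm]
  simp [this]

/-- For each subtree `t` of the root, either its edge is cut, which leaves the scalar `φ(t)`, or the
edge is kept and `t` is cut further, which leaves `trunk φ t`. The two options add up to `translate
φ t`, and independent choices multiply. -/
theorem trunk_node (φ : Character) (s : Multiset RTree) :
    trunk φ (RTree.node s) = graft (translate φ (forest s)) := by
  rw [trunk, RTree.admCuts_node, Multiset.map_map]
  refine (sum_choices (fun a => φ (forest a)) (by simp) (by simp) _).trans ?_
  rw [algHom_forest, Multiset.map_map]
  refine congrArg (fun x => graft (Multiset.prod x)) (Multiset.map_congr rfl fun t _ => ?_)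
  simp [translate_tree, trunk, Multiset.map_map, add_comm, MvPolynomial.C_eq_smul_one]

/-- This is the Hochschild cocycle property of grafting. It extends the recursion for trees
linearly, so that it can be applied again to the output of another `translate`. -/
theorem translate_graft (φ : Character) (x : H) :
    translate φ (graft x) = MvPolynomial.C (φ (graft x)) + graft (translate φ x) := by
  induction x using MvPolynomial.induction_on' with
  | add p q hp hq => rw [map_add, map_add, hp, hq, map_add, map_add, map_add, map_add]; ring
  | monomial m a =>
    classical
    have : MvPolynomial.monomial m a = a • forest (Finsupp.toMultiset m) := by
      rw [forest_eq_monomial, Finsupp.toMultiset_toFinsupp, MvPolynomial.smul_monomial, smul_eq_mul,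
        mul_one]
    rw [this]
    simp only [map_smul, graft_forest, translate_tree, trunk_node, smul_add, smul_eq_mul,
      MvPolynomial.C_mul]
    rw [MvPolynomial.smul_eq_C_mul]

theorem conv_apply (φ₁ φ₂ : Character) (x : H) : conv φ₁ φ₂ x = φ₂ (translate φ₁ x) := by
  have : conv φ₁ φ₂ = φ₂.comp (translate φ₁) := by
    refine algHom_ext_tree fun t => ?_
    have h : coproduct (tree t) = tree t ⊗ₜ[ℝ] (1 : H) +
        (t.admCuts.map fun c => forest c.2 ⊗ₜ[ℝ] tree c.1).sum := by
      simp [coproduct, tree]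
    simp only [conv, AlgHom.comp_apply, h, translate_tree, trunk, map_add, map_multiset_sum,
      Multiset.map_map, Function.comp_def, Algebra.TensorProduct.map_tmul,
      Algebra.TensorProduct.lmul'_apply_tmul, map_one, mul_one, map_smul, smul_eq_mul]
    congr 1
    simp [← MvPolynomial.algebraMap_eq]
  rw [this, AlgHom.comp_apply]

/-- This is coassociativity: both sides obey the same cocycle recursion, so they agree by induction
on trees. -/
theorem translate_conv (φ₁ φ₂ : Character) :
    translate (conv φ₁ φ₂) = (translate φ₂).comp (translate φ₁) := by
  refine algHom_ext_tree fun t => ?_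
  induction t using RTree.ind with
  | h s ih =>
    have hs : translate (conv φ₁ φ₂) (forest s) = translate φ₂ (translate φ₁ (forest s)) := by
      rw [algHom_forest, Multiset.map_congr rfl ih, ← algHom_forest, AlgHom.comp_apply]
    rw [← graft_forest, AlgHom.comp_apply, translate_graft, translate_graft, map_add,
      translate_graft, hs, conv_apply, translate_graft, map_add, map_add]
    simp [← MvPolynomial.algebraMap_eq, add_assoc]

theorem conv_assoc (φ₁ φ₂ φ₃ : Character) :
    conv (conv φ₁ φ₂) φ₃ = conv φ₁ (conv φ₂ φ₃) := by
  refine AlgHom.ext fun x => ?_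
  rw [conv_apply, conv_apply, conv_apply, translate_conv, AlgHom.comp_apply]

theorem counit_graft (x : H) : counit (graft x) = 0 := by
  have : counit.toLinearMap ∘ₗ graft = 0 := by
    refine (MvPolynomial.basisMonomials RTree ℝ).ext fun m => ?_
    simp [graft_monomial, counit, tree]
  exact LinearMap.congr_fun this x

theorem translate_counit : translate counit = AlgHom.id ℝ H := by
  refine algHom_ext_tree fun t => ?_
  induction t using RTree.ind with
  | h s ih =>
    have hs : translate counit (forest s) = forest s := by
      rw [algHom_forest, Multiset.map_congr rfl ih, ← algHom_forest, AlgHom.id_apply]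
    rw [← graft_forest, translate_graft, hs, counit_graft]
    simp

theorem counit_conv (φ : Character) : conv counit φ = φ :=
  AlgHom.ext fun x => by rw [conv_apply, translate_counit, AlgHom.id_apply]

theorem counit_trunk (φ : Character) (t : RTree) : counit (trunk φ t) = 0 := by
  rw [← RTree.node_children t, trunk_node, counit_graft]

theorem conv_counit (φ : Character) : conv φ counit = φ :=
  algHom_ext_tree fun t => by
    rw [conv_apply, translate_tree, map_add, counit_trunk, ← MvPolynomial.algebraMap_eq,
      AlgHom.commutes]
    simp

/-- `∑ (-1) ^ |c| ψ(P_c(τ)) R_c(τ)` over all cuts of `τ`. -/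
def signedTrunk (ψ : Character) (t : RTree) : H :=
  (t.cuts.map fun c => ((-1) ^ c.2.card * ψ (forest c.2)) • tree c.1).sum

theorem apply_antipode_tree (ψ : Character) (t : RTree) :
    ψ (antipode (tree t)) = -ψ (signedTrunk ψ t) := by
  have h : antipode (tree t) =
      (t.cuts.map fun c => (-1 : H) ^ (c.2.card + 1) * (tree c.1 * forest c.2)).sum := by
    simp [antipode, tree]
  rw [h, signedTrunk, map_multiset_sum, map_multiset_sum, ← Multiset.sum_map_neg', Multiset.map_map,
    Multiset.map_map, Multiset.map_map]
  refine congrArg Multiset.sum (Multiset.map_congr rfl fun c _ => ?_)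
  simp
  ring

/-- If the edge to a subtree `t` is kept, it contributes `signedTrunk ψ t`. If it is removed, the
root component of `t` joins the cut-off forest with one more sign, and the sum over the cuts of `t`
is `ψ (S t)`. -/
theorem signedTrunk_node (ψ : Character) (s : Multiset RTree) :
    signedTrunk ψ (RTree.node s) = graft (s.map fun t =>
      MvPolynomial.C (ψ (antipode (tree t))) + signedTrunk ψ t).prod := by
  rw [signedTrunk, RTree.cuts_node, Multiset.map_map]
  refine (sum_choices (fun a => (-1) ^ a.card * ψ (forest a)) (by simp)
    (fun a b => by simp [pow_add]; ring) _).trans ?_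
  rw [Multiset.map_map]
  refine congrArg (fun x => graft (Multiset.prod x)) (Multiset.map_congr rfl fun t _ => ?_)
  simp only [Function.comp_apply, Multiset.map_add, Multiset.map_map, Multiset.sum_add,
    forest_singleton]
  rw [add_comm, apply_antipode_tree, ← signedTrunk]
  congr 1
  rw [signedTrunk, map_multiset_sum, ← Multiset.sum_map_neg', Multiset.map_map,
    map_multiset_sum, Multiset.map_map, Multiset.map_map]
  refine congrArg Multiset.sum (Multiset.map_congr rfl fun c _ => ?_)
  simp only [Function.comp_apply, Multiset.card_add, Multiset.card_singleton, forest_add,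
    forest_singleton, map_mul, forest_zero, map_smul, smul_eq_mul]
  rw [← MvPolynomial.C_eq_smul_one]
  congr 1
  ring

/-- The factor of a subtree in `signedTrunk_node` is exactly its translate by the character `ψ ∘ S`,
so the two recursions coincide. -/
theorem signedTrunk_eq_trunk (ψ : Character) (t : RTree) :
    signedTrunk ψ t = trunk (ψ.comp antipode) t := by
  induction t using RTree.ind with
  | h s ih =>
    rw [signedTrunk_node, trunk_node, algHom_forest]
    refine congrArg (fun x => graft (Multiset.prod x)) (Multiset.map_congr rfl fun t ht => ?_)
    rw [translate_tree, ih t ht, AlgHom.comp_apply]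

/-- The left inverse of a character. -/
theorem conv_antipode_left (ψ : Character) : conv (ψ.comp antipode) ψ = counit := by
  refine algHom_ext_tree fun t => ?_
  rw [conv_apply, translate_tree, ← signedTrunk_eq_trunk, map_add, AlgHom.comp_apply,
    ← MvPolynomial.algebraMap_eq, AlgHom.commutes, apply_antipode_tree]
  simp [counit, tree]

/-- The right inverse of a character. -/
theorem conv_antipode_right (ψ : Character) : conv ψ (ψ.comp antipode) = counit := by
  -- The left inverse of `ψ` has a left inverse itself; in a monoid this makes it a right inverse of
  -- `ψ` too.
  have h := conv_antipode_left (ψ.comp antipode)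
  calc conv ψ (ψ.comp antipode)
      = conv counit (conv ψ (ψ.comp antipode)) := (counit_conv _).symm
    _ = counit := by
      rw [← h, conv_assoc, ← conv_assoc _ ψ, conv_antipode_left, counit_conv]

theorem eq_of_conv_eq_counit {φ ψ : Character} (h : conv φ ψ = counit) :
    φ = ψ.comp antipode := by
  rw [← conv_counit φ, ← conv_antipode_right ψ, ← conv_assoc, h, counit_conv]

/-! ### The canonical involution -/

theorem involution_tree (t : RTree) : involution (tree t) = (-1 : H) ^ t.order * tree t := by
  simp [involution, tree]

theorem bar_tree (ψ : Character) (t : RTree) :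
    bar ψ (tree t) = (-1 : ℝ) ^ t.order * ψ (tree t) := by
  simp [bar, involution_tree]

theorem involution_involution (x : H) : involution (involution x) = x := by
  have : involution.comp involution = AlgHom.id ℝ H := algHom_ext_tree fun t => by
    simp [involution_tree, ← mul_assoc, ← mul_pow]
  exact DFunLike.congr_fun this x

theorem involution_forest (s : Multiset RTree) :
    involution (forest s) = (-1 : H) ^ (s.map RTree.order).sum * forest s := by
  induction s using Multiset.induction_on with
  | empty => simp
  | cons t s ih => simp [ih, involution_tree, pow_add]; ring

/-- The minus sign accounts for the new root. -/
theorem involution_graft (x : H) : involution (graft x) = -graft (involution x) := by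
  have : involution.toLinearMap ∘ₗ graft = -(graft ∘ₗ involution.toLinearMap) := by
    refine (MvPolynomial.basisMonomials RTree ℝ).ext fun m => ?_
    classical
    have hm : MvPolynomial.basisMonomials RTree ℝ m = forest (Finsupp.toMultiset m) := by
      rw [MvPolynomial.coe_basisMonomials, forest_eq_monomial, Finsupp.toMultiset_toFinsupp]
    rw [hm]
    generalize Finsupp.toMultiset m = s
    -- `graft` is linear over `ℝ` only, so a sign that lives in `H` is extracted by distinguishing
    -- its two values.
    have hneg : ∀ n : ℕ, ∀ z : H, graft ((-1 : H) ^ n * z) = (-1 : H) ^ n * graft z := by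
      intro n z
      rcases neg_one_pow_eq_or H n with h | h <;> simp [h]
    simp only [LinearMap.comp_apply, LinearMap.neg_apply, AlgHom.toLinearMap_apply, graft_forest,
      involution_tree, involution_forest, hneg, RTree.order_node, pow_add]
    ring
  exact LinearMap.congr_fun this x

/-- A cut preserves the number of nodes, so the sign of `R_c` is the sign of the whole tree times
that of `P_c`, and the latter turns `ψ` into `bar ψ`. The induction runs through the product formula
for `signedTrunk`. -/
theorem involution_signedTrunk (ψ : Character) (t : RTree) :
    involution (signedTrunk ψ t) = (-1 : H) ^ t.order * signedTrunk (bar ψ) t := by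
  induction t using RTree.ind with
  | h s ih =>
    have hneg : ∀ n : ℕ, ∀ z : H, graft ((-1 : H) ^ n * z) = (-1 : H) ^ n * graft z := by
      intro n z
      rcases neg_one_pow_eq_or H n with h | h <;> simp [h]
    have key : ∀ s : Multiset RTree,
        (∀ t ∈ s, involution (signedTrunk ψ t) = (-1 : H) ^ t.order * signedTrunk (bar ψ) t) →
        involution (s.map fun t =>
          MvPolynomial.C (ψ (antipode (tree t))) + signedTrunk ψ t).prod =
        (-1 : H) ^ (s.map RTree.order).sum * (s.map fun t =>
          MvPolynomial.C (bar ψ (antipode (tree t))) + signedTrunk (bar ψ) t).prod := by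
      intro s
      induction s using Multiset.induction_on with
      | empty => simp
      | cons t s ihs =>
        intro h
        have h1 := h t (Multiset.mem_cons_self t s)
        have h2 : ψ (antipode (tree t)) = (-1) ^ t.order * bar ψ (antipode (tree t)) := by
          rw [apply_antipode_tree, apply_antipode_tree]
          have := congrArg involution h1
          rw [involution_involution] at this
          rw [this]
          simp [bar]
        have hC : ∀ a : ℝ, involution (MvPolynomial.C a) = MvPolynomial.C a := by
          intro a
          rw [← MvPolynomial.algebraMap_eq, AlgHom.commutes]
        rw [Multiset.map_cons, Multiset.prod_cons, map_mul, ihs fun r hr =>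
          h r (Multiset.mem_cons_of_mem hr), map_add, h1, hC, h2]
        simp only [Multiset.map_cons, Multiset.sum_cons, Multiset.prod_cons, pow_add, map_mul,
          map_pow, map_neg, map_one]
        ring
    rw [signedTrunk_node, involution_graft, key s ih, hneg, signedTrunk_node, RTree.order_node,
      pow_add]
    ring

theorem bar_comp_antipode (ψ : Character) :
    (bar ψ).comp antipode = bar (ψ.comp antipode) := by
  refine algHom_ext_tree fun t => ?_
  rw [bar_tree, AlgHom.comp_apply, AlgHom.comp_apply, apply_antipode_tree, apply_antipode_tree,
    ← involution_involution (signedTrunk ψ t), involution_signedTrunk, bar, AlgHom.comp_apply]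
  simp [← mul_assoc, ← mul_pow]

/-! ### Dual description of the translation -/

/-- Only the multiplicity of `t` changes, and its factorial gains the factor `count + 1`. This
factor is what matches repeated subtrees with derivatives of monomials below. -/
theorem symmetryFactor_cons [inst : DecidableEq RTree] (t : RTree) (s : Multiset RTree) :
    (RTree.node (t ::ₘ s)).symmetryFactor =
      (s.count t + 1) * t.symmetryFactor * (RTree.node s).symmetryFactor := by
  obtain rfl : inst = fun a b => Classical.propDecidable (a = b) := Subsingleton.elim _ _
  classical
  have hs : ∏ r ∈ s.toFinset, (s.count r).factorial =
      ∏ r ∈ (t ::ₘ s).toFinset, (s.count r).factorial := by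
    refine Finset.prod_subset (Multiset.toFinset_subset.2 (Multiset.subset_cons s t))
      fun r _ hr => ?_
    rw [Multiset.mem_toFinset] at hr
    simp [Multiset.count_eq_zero_of_notMem hr]
  have ht : t ∈ (t ::ₘ s).toFinset := by simp
  rw [RTree.symmetryFactor_node, RTree.symmetryFactor_node, hs, ← Finset.mul_prod_erase _ _ ht,
    ← Finset.mul_prod_erase _ _ ht, Multiset.count_cons_self, Nat.factorial_succ,
    Finset.prod_congr rfl fun r hr => by
      rw [Multiset.count_cons_of_ne (Finset.ne_of_mem_erase hr)],
    Multiset.map_cons, Multiset.prod_cons]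
  ring

theorem symmetryFactor_pos (t : RTree) : 0 < t.symmetryFactor := by
  classical
  induction t using RTree.ind with
  | h s ih =>
    induction s using Multiset.induction_on with
    | empty => simp [RTree.symmetryFactor_node]
    | cons t s ihs =>
      rw [symmetryFactor_cons]
      have h1 := ih t (Multiset.mem_cons_self t s)
      have h2 := ihs fun r hr => ih r (Multiset.mem_cons_of_mem hr)
      positivity

theorem derivation_multiset_prod {R A ι : Type*} [CommSemiring R] [CommRing A] [Algebra R A]
    [DecidableEq ι] (D : Derivation R A A) (f : ι → A) (s : Multiset ι) :
    D (s.map f).prod = (s.map fun i => D (f i) * ((s.erase i).map f).prod).sum := by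
  induction s using Multiset.induction_on with
  | empty => simp
  | cons a s ih =>
    rw [Multiset.map_cons, Multiset.prod_cons, D.leibniz, ih, Multiset.map_cons, Multiset.sum_cons,
      Multiset.erase_cons_head, add_comm, smul_eq_mul, smul_eq_mul, mul_comm, add_right_inj,
      ← Multiset.sum_map_mul_left]
    refine congrArg Multiset.sum (Multiset.map_congr rfl fun i hi => ?_)
    rcases eq_or_ne i a with rfl | h
    · rw [Multiset.erase_cons_head]
      conv_rhs => rw [← Multiset.cons_erase hi]
      simp only [Multiset.map_cons, Multiset.prod_cons]
      ring
    · rw [Multiset.erase_cons_tail _ h.symm, Multiset.map_cons, Multiset.prod_cons]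
      ring

open Classical in
/-- `D_{α₁} ⋯ D_{αₘ} (forest s)` evaluated at `φ`, where `D_α` is the derivation of `H` with
`D_α t = α t` for all trees `t`. -/
def extract (φ : RTree → ℝ) : List (RTree → ℝ) → Multiset RTree → ℝ
  | [], s => (s.map φ).prod
  | α :: as, s => (s.map fun t => α t * extract φ as (s.erase t)).sum

/-- The coefficient of the tree `t` in the Taylor expansion of the elementary differential of
`u` along the B-series of `φ`. -/
def taylorCoeff (φ : Character) (u t : RTree) : ℝ :=
  u.symmetryFactor * MvPolynomial.coeff (Finsupp.single u 1) (trunk φ t)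

theorem coeff_zero_eq_counit (x : H) : MvPolynomial.coeff 0 x = counit x := by
  rw [counit]
  simp [MvPolynomial.constantCoeff_eq, MvPolynomial.aeval_eq_constantCoeff_of_vars]

/-- A trunk is a linear form in the trees, so its partial derivatives are constants. -/
theorem pderiv_trunk (φ : Character) (u t : RTree) :
    MvPolynomial.pderiv u (trunk φ t) =
      MvPolynomial.C (MvPolynomial.coeff (Finsupp.single u 1) (trunk φ t)) := by
  classical
  unfold trunk
  induction t.admCuts using Multiset.induction_on with
  | empty => simp
  | cons c s ih =>
    rw [Multiset.map_cons, Multiset.sum_cons, map_add, ih, MvPolynomial.coeff_add, map_add]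
    congr 1
    by_cases h : c.1 = u
    · simp [tree, MvPolynomial.smul_eq_C_mul, h]
    · simp [tree, MvPolynomial.smul_eq_C_mul, MvPolynomial.coeff_X, MvPolynomial.pderiv_X_of_ne h,
        Finsupp.single_left_inj, h]

/-- Iterated partial derivatives of `translate φ (forest s)`, evaluated at zero, can be read in two
ways. The Leibniz rule gives `extract`, since each factor is a constant `φ(t)` plus a linear form;
reading off the monomial gives its coefficient times the factorials of the multiplicities. The
remaining factors of the symmetry coefficient are absorbed in `taylorCoeff`. -/
theorem extract_taylorCoeff [DecidableEq RTree] (φ : Character) (us : List RTree)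
    (s : Multiset RTree) :
    extract (fun t => φ (tree t)) (us.map (taylorCoeff φ)) s =
      (RTree.node us).symmetryFactor *
        MvPolynomial.coeff (Multiset.toFinsupp (us : Multiset RTree)) (translate φ (forest s)) := by
  induction us generalizing s with
  | nil =>
    have h1 : (RTree.node (([] : List RTree) : Multiset RTree)).symmetryFactor = 1 := by
      simp [RTree.symmetryFactor_node]
    have hC : ∀ a : ℝ, counit (MvPolynomial.C a) = a := by
      intro a
      rw [← MvPolynomial.algebraMap_eq, AlgHom.commutes]
      rfl
    rw [h1, Multiset.coe_nil, map_zero, coeff_zero_eq_counit, algHom_forest, map_multiset_prod,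
      Multiset.map_map]
    simp [extract, translate_tree, counit_trunk, hC]
  | cons u us ih =>
    have hp := MvPolynomial.coeff_pderiv (i := u) (translate φ (forest s))
      (Multiset.toFinsupp (us : Multiset RTree))
    have hW : MvPolynomial.pderiv u (translate φ (forest s)) = (s.map fun t =>
        MvPolynomial.C (MvPolynomial.coeff (Finsupp.single u 1) (trunk φ t)) *
          translate φ (forest (s.erase t))).sum := by
      rw [algHom_forest, derivation_multiset_prod]
      refine congrArg Multiset.sum (Multiset.map_congr rfl fun t _ => ?_)
      rw [algHom_forest, translate_tree, map_add, pderiv_trunk, MvPolynomial.pderiv_C, zero_add]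
    have hu : Multiset.toFinsupp ((u :: us : List RTree) : Multiset RTree) =
        Multiset.toFinsupp (us : Multiset RTree) + Finsupp.single u 1 := by
      rw [← Multiset.cons_coe, ← Multiset.singleton_add, map_add, Multiset.toFinsupp_singleton,
        add_comm]
    rw [hu, ← Multiset.cons_coe, symmetryFactor_cons]
    rw [hW, Multiset.toFinsupp_apply] at hp
    push_cast
    rw [mul_comm ((((us : Multiset RTree).count u : ℝ) + 1)), mul_assoc, mul_assoc,
      mul_comm ((((us : Multiset RTree).count u : ℝ) + 1)), mul_assoc, ← hp]
    have hcoeff : ∀ (m : RTree →₀ ℕ) (S : Multiset H),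
        MvPolynomial.coeff m S.sum = (S.map (MvPolynomial.coeff m)).sum := fun m S =>
      map_multiset_sum (MvPolynomial.coeffAddMonoidHom m) S
    rw [hcoeff, Multiset.map_map, List.map_cons, extract, ← mul_assoc, ← Multiset.sum_map_mul_left]
    refine congrArg Multiset.sum (Multiset.map_congr rfl fun t _ => ?_)
    have e : @Multiset.erase _ (fun a b => Classical.propDecidable (a = b)) s t = s.erase t := by
      congr!
    rw [e, ih, taylorCoeff, Function.comp_apply, MvPolynomial.coeff_C_mul]
    ring

theorem coeff_single_graft (s : Multiset RTree) (x : H) [DecidableEq RTree] :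
    MvPolynomial.coeff (Finsupp.single (RTree.node s) 1) (graft x) =
      MvPolynomial.coeff (Multiset.toFinsupp s) x := by
  have : MvPolynomial.lcoeff ℝ (Finsupp.single (RTree.node s) 1) ∘ₗ graft =
      MvPolynomial.lcoeff ℝ (Multiset.toFinsupp s) := by
    refine (MvPolynomial.basisMonomials RTree ℝ).ext fun m => ?_
    have h : RTree.node (Finsupp.toMultiset m) = RTree.node s ↔ m = Multiset.toFinsupp s := by
      rw [RTree.node_injective.eq_iff]
      constructor
      · rintro rfl; simp
      · rintro rfl; simp
    simp [graft_monomial, tree, MvPolynomial.coeff_X, MvPolynomial.coeff_monomial,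
      Finsupp.single_left_inj, h]
  exact LinearMap.congr_fun this x

/-- The cocycle recursion for trunks, dualized: this is the form in which the coefficients appear
when an elementary differential is Taylor expanded. -/
theorem taylorCoeff_node (φ : Character) (us : List RTree) (s : Multiset RTree) :
    taylorCoeff φ (RTree.node us) (RTree.node s) =
      extract (fun t => φ (tree t)) (us.map (taylorCoeff φ)) s := by
  classical
  rw [extract_taylorCoeff, taylorCoeff, trunk_node, coeff_single_graft]

/-! ### Jets in a commutative algebra with derivations -/

section Jet

variable {ι A B : Type*} [Fintype ι] [CommRing A] [Algebra ℝ A] [CommRing B] [Algebra ℝ B]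

/-- The derivative of `g` in the directions of a list of vectors with entries in `B`, where
functions are evaluated by `ev`. -/
def jet (D : ι → Derivation ℝ A A) (ev : A →ₗ[ℝ] B) : List (ι → B) → A →ₗ[ℝ] B
  | [] => ev
  | w :: ws => ∑ i, (LinearMap.mulLeft ℝ (w i)) ∘ₗ (jet D ev ws) ∘ₗ (D i : A →ₗ[ℝ] A)

variable (D : ι → Derivation ℝ A A)

@[simp] theorem jet_nil (ev : A →ₗ[ℝ] B) : jet D ev [] = ev := rfl

theorem jet_cons (ev : A →ₗ[ℝ] B) (w : ι → B) (ws : List (ι → B)) (g : A) :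
    jet D ev (w :: ws) g = ∑ i, w i * jet D ev ws (D i g) := by
  simp [jet]

theorem jet_append_sum {κ : Type*} (ev : A →ₗ[ℝ] B) (l l' : List (ι → B)) (S : Finset κ)
    (c : κ → B) (v : κ → ι → B) (g : A) :
    jet D ev (l ++ (fun j => ∑ t ∈ S, c t * v t j) :: l') g =
      ∑ t ∈ S, c t * jet D ev (l ++ v t :: l') g := by
  induction l generalizing g with
  | nil =>
    simp only [List.nil_append, jet_cons, Finset.sum_mul, Finset.mul_sum]
    rw [Finset.sum_comm]
    simp only [mul_assoc]
  | cons w l ih =>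
    simp only [List.cons_append, jet_cons, ih, Finset.mul_sum]
    rw [Finset.sum_comm]
    exact Finset.sum_congr rfl fun _ _ => Finset.sum_congr rfl fun _ _ => by ring

theorem jet_map_smul (ev : A →ₗ[ℝ] B) {κ : Type*} (l : List κ) (c : κ → B) (v : κ → ι → B)
    (l' : List (ι → B)) (g : A) :
    jet D ev (l.map (fun k j => c k * v k j) ++ l') g =
      (l.map c).prod * jet D ev (l.map v ++ l') g := by
  induction l generalizing g with
  | nil => simp
  | cons k l ih =>
    simp only [List.map_cons, List.cons_append, jet_cons, ih, List.prod_cons, Finset.mul_sum]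
    exact Finset.sum_congr rfl fun _ _ => by ring

/-- The directions are factors outside the derivations and are never differentiated, so the ordinary
binomial Leibniz rule holds even though the derivations are not assumed to commute. -/
theorem jet_replicate_mul (ev : A →ₐ[ℝ] B) (δ : ι → B) (n : ℕ) (g g' : A) :
    jet D ev.toLinearMap (List.replicate n δ) (g * g') =
      ∑ p ∈ Finset.HasAntidiagonal.antidiagonal n, (n.choose p.1 : B) *
        (jet D ev.toLinearMap (List.replicate p.1 δ) g *
          jet D ev.toLinearMap (List.replicate p.2 δ) g') := by
  induction n generalizing g g' with
  | zero => simp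
  | succ n ih =>
    rw [Finset.sum_antidiagonal_choose_succ_mul (fun a b =>
      jet D ev.toLinearMap (List.replicate a δ) g * jet D ev.toLinearMap (List.replicate b δ) g')]
    simp only [List.replicate_succ, jet_cons, Derivation.leibniz, smul_eq_mul, map_add, ih,
      mul_add, Finset.sum_add_distrib, Finset.mul_sum, Finset.sum_mul]
    congr 1
    · rw [Finset.sum_comm]
      exact Finset.sum_congr rfl fun _ _ => Finset.sum_congr rfl fun _ _ => by ring
    · rw [Finset.sum_comm]
      conv_lhs => rw [← Finset.HasAntidiagonal.map_swap_antidiagonal, Finset.sum_map]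
      refine Finset.sum_congr rfl fun _ _ => Finset.sum_congr rfl fun _ _ => ?_
      simp
      ring

/-- The Taylor expansion, truncated at order `K`, at the point given by `ev` with increment `δ`. -/
def taylor (ev : A →ₗ[ℝ] B) (δ : ι → B) (K : ℕ) : A →ₗ[ℝ] B :=
  ∑ k ∈ Finset.range (K + 1), ((k.factorial : ℝ)⁻¹) • jet D ev (List.replicate k δ)

theorem taylor_apply (ev : A →ₗ[ℝ] B) (δ : ι → B) (K : ℕ) (g : A) :
    taylor D ev δ K g =
      ∑ k ∈ Finset.range (K + 1), ((k.factorial : ℝ)⁻¹) • jet D ev (List.replicate k δ) g := by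
  simp [taylor]

theorem jet_taylor (ev : A →ₗ[ℝ] B) (δ : ι → B) (K : ℕ) (ws : List (ι → B)) (g : A) :
    jet D (taylor D ev δ K) ws g =
      ∑ k ∈ Finset.range (K + 1), ((k.factorial : ℝ)⁻¹) •
        jet D ev (ws ++ List.replicate k δ) g := by
  induction ws generalizing g with
  | nil => simp [taylor_apply]
  | cons w ws ih =>
    simp only [jet_cons, ih, List.cons_append, Finset.mul_sum, Finset.smul_sum]
    rw [Finset.sum_comm]
    simp only [mul_smul_comm]

/-- The Taylor operator is a truncated exponential of a derivation. The truncation costs nothing: a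
product of terms of total degree above `K` carries a vanishing power of `ε`. -/
theorem taylor_mul (ev : A →ₐ[ℝ] B) {ε : B} {K : ℕ} (hε : ε ^ (K + 1) = 0) (δ : ι → B) (g g' : A) :
    taylor D ev.toLinearMap (fun i => ε * δ i) K (g * g') =
      taylor D ev.toLinearMap (fun i => ε * δ i) K g *
        taylor D ev.toLinearMap (fun i => ε * δ i) K g' := by
  set δ' : ι → B := fun i => ε * δ i
  set q : ℕ → A → B := fun k x =>
    ((k.factorial : ℝ)⁻¹) • jet D ev.toLinearMap (List.replicate k δ') x with hq
  have hT : ∀ x, taylor D ev.toLinearMap δ' K x = ∑ k ∈ Finset.range (K + 1), q k x :=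
    taylor_apply D _ _ _
  have hmul : ∀ n, q n (g * g') = ∑ p ∈ Finset.HasAntidiagonal.antidiagonal n, q p.1 g * q p.2 g' := by
    intro n
    simp only [hq]
    rw [jet_replicate_mul, Finset.smul_sum]
    refine Finset.sum_congr rfl fun p hp => ?_
    rw [Finset.HasAntidiagonal.mem_antidiagonal] at hp
    subst hp
    rw [smul_mul_smul_comm, ← nsmul_eq_mul, ← Nat.cast_smul_eq_nsmul ℝ, smul_smul]
    congr 1
    rw [Nat.cast_add_choose]
    have h1 : ((p.1 + p.2).factorial : ℝ) ≠ 0 := by positivity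
    field_simp
  have hzero : ∀ a b, K < a + b → q a g * q b g' = 0 := by
    intro a b hab
    have hpow : ∀ k x, jet D ev.toLinearMap (List.replicate k δ') x =
        ε ^ k * jet D ev.toLinearMap (List.replicate k δ) x := by
      intro k x
      have := jet_map_smul D ev.toLinearMap (List.replicate k ()) (fun _ => ε) (fun _ => δ) [] x
      simpa [List.map_replicate] using this
    simp only [hq, hpow]
    rw [smul_mul_smul_comm, mul_mul_mul_comm, ← pow_add,
      pow_eq_zero_of_le (Nat.succ_le_of_lt hab) hε, zero_mul, smul_zero]
  rw [hT, hT, hT, Finset.sum_mul_sum, ← Finset.sum_product']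
  rw [← Finset.sum_filter_of_ne (p := fun x : ℕ × ℕ => x.1 + x.2 ∈ Finset.range (K + 1))
    (s := Finset.range (K + 1) ×ˢ Finset.range (K + 1))]
  · rw [← Finset.sum_fiberwise_of_maps_to (t := Finset.range (K + 1)) (g := fun x : ℕ × ℕ => x.1 + x.2)
      (fun x hx => (Finset.mem_filter.1 hx).2)]
    refine Finset.sum_congr rfl fun n hn => ?_
    rw [hmul]
    refine Finset.sum_congr ?_ fun _ _ => rfl
    ext ⟨a, b⟩
    simp only [Finset.mem_range] at hn
    simp only [Finset.HasAntidiagonal.mem_antidiagonal, Finset.mem_filter, Finset.mem_product, Finset.mem_range]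
    omega
  · intro x _ hx
    by_contra h
    rw [Finset.mem_range] at h
    exact hx (hzero _ _ (by omega))

theorem jet_replicate_one (ev : A →ₗ[ℝ] B) (δ : ι → B) (k : ℕ) :
    jet D ev (List.replicate (k + 1) δ) 1 = 0 := by
  simp [List.replicate_succ, jet_cons]

/-- The Taylor expansion with nilpotent increment is an algebra homomorphism. -/
def taylorHom (ev : A →ₐ[ℝ] B) {ε : B} {K : ℕ} (hε : ε ^ (K + 1) = 0) (δ : ι → B) : A →ₐ[ℝ] B :=
  AlgHom.ofLinearMap (taylor D ev.toLinearMap (fun i => ε * δ i) K)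
    (by
      rw [taylor_apply, Finset.sum_range_succ', Finset.sum_eq_zero fun k _ => by
        rw [jet_replicate_one, smul_zero]]
      simp)
    (taylor_mul D ev hε δ)

/-- Directions enter a jet only as multipliers, so `T` passes through by multiplicativity and need
not be compatible with any derivation of `B`. -/
theorem map_jet_id (T : A →ₐ[ℝ] B) (ws : List (ι → A)) (g : A) :
    T (jet D LinearMap.id ws g) = jet D T.toLinearMap (ws.map fun w i => T (w i)) g := by
  induction ws generalizing g with
  | nil => simp
  | cons w ws ih => simp [jet_cons, ih]

end Jet

/-! ### Taylor expansion of elementary differentials along a B-series -/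

/-- The finite set of the trees with at most `n` nodes. -/
def treesLE (n : ℕ) : Finset RTree := (RTree.finite_order_le n).toFinset

@[simp] theorem mem_treesLE {n : ℕ} {t : RTree} : t ∈ treesLE n ↔ t.order ≤ n := by
  simp [treesLE]

theorem children_injective : Function.Injective RTree.children :=
  Function.LeftInverse.injective RTree.node_children

/-- The finite set of the forests with at most `n` nodes. -/
def forestsLE (n : ℕ) : Finset (Multiset RTree) :=
  (treesLE (n + 1)).map ⟨RTree.children, children_injective⟩

theorem mem_forestsLE {n : ℕ} {s : Multiset RTree} :
    s ∈ forestsLE n ↔ (s.map RTree.order).sum ≤ n := by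
  simp only [forestsLE, Finset.mem_map, mem_treesLE, Function.Embedding.coeFn_mk]
  constructor
  · rintro ⟨t, ht, rfl⟩
    rw [← RTree.node_children t, RTree.order_node] at ht
    omega
  · intro h
    refine ⟨RTree.node s, ?_, RTree.children_node s⟩
    rw [RTree.order_node]
    omega

theorem card_le_sum_order (s : Multiset RTree) : s.card ≤ (s.map RTree.order).sum := by
  have h := Multiset.card_nsmul_le_sum (s := s.map RTree.order) (a := 1) (by
    intro x hx
    obtain ⟨t, -, rfl⟩ := Multiset.mem_map.1 hx
    exact RTree.order_pos t)
  simpa using h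

open Classical in
theorem sum_map_mul_prod_erase (φ : RTree → ℝ) (s : Multiset RTree) :
    (s.map fun t => φ t * ((s.erase t).map φ).prod).sum = s.card * (s.map φ).prod := by
  rw [Multiset.map_congr rfl fun t ht => by
    rw [← Multiset.prod_cons, ← Multiset.map_cons, Multiset.cons_erase ht]]
  simp

/-- Differentiating a monomial `k` times and evaluating at zero leaves something only if its degree
is `k`; then each of the `k!` orders contributes the same product. -/
theorem extract_zero_replicate (φ : RTree → ℝ) (k : ℕ) (s : Multiset RTree) :
    extract 0 (List.replicate k φ) s =
      if s.card = k then (k.factorial : ℝ) * (s.map φ).prod else 0 := by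
  classical
  induction k generalizing s with
  | zero =>
    induction s using Multiset.induction_on with
    | empty => simp [extract]
    | cons t s _ => simp [extract]
  | succ k ih =>
    have h : ∀ t ∈ s, (s.erase t).card = k ↔ s.card = k + 1 := by
      intro t ht
      have h1 := Multiset.card_erase_of_mem ht
      have h2 := Multiset.card_pos_iff_exists_mem.2 ⟨t, ht⟩
      rw [h1, Nat.pred_eq_sub_one]
      omega
    rw [List.replicate_succ, extract]
    split_ifs with hs
    · rw [Multiset.map_congr rfl fun t ht => by
        rw [show (fun a b => Classical.propDecidable (a = b)) = (inferInstance : DecidableEq RTree)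
          from Subsingleton.elim _ _, ih, if_pos ((h t ht).2 hs), mul_left_comm]]
      rw [Multiset.sum_map_mul_left, sum_map_mul_prod_erase, hs, Nat.factorial_succ]
      push_cast
      ring
    · rw [Multiset.map_congr rfl fun t ht => by
        rw [ih, if_neg (fun h' => hs ((h t ht).1 h')), mul_zero]]
      simp

theorem extract_cons_eq_sum [inst : DecidableEq RTree] (φ α : RTree → ℝ) (as : List (RTree → ℝ))
    (s : Multiset RTree) :
    extract φ (α :: as) s = ∑ t ∈ s.toFinset, s.count t * (α t * extract φ as (s.erase t)) := by
  obtain rfl : inst = fun a b => Classical.propDecidable (a = b) := Subsingleton.elim _ _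
  classical
  simp only [extract, Finset.sum_multiset_map_count, nsmul_eq_mul]

/-- This is Taylor's formula for the monomial `s`: the exponential of the derivation attached to
`φ`, followed by evaluation at zero, is evaluation at `φ`. Degrees above `K` do not occur because
`s` has at most `K` trees. -/
theorem sum_extract_zero (φ : RTree → ℝ) (as : List (RTree → ℝ)) (K : ℕ) (s : Multiset RTree)
    (hs : s.card ≤ K) :
    ∑ k ∈ Finset.range (K + 1), ((k.factorial : ℝ)⁻¹) * extract 0 (as ++ List.replicate k φ) s =
      extract φ as s := by
  classical
  induction as generalizing s with
  | nil =>
    simp only [List.nil_append, extract_zero_replicate, mul_ite, mul_zero, Finset.sum_ite_eq,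
      Finset.mem_range, Nat.lt_succ_of_le hs, if_true, extract]
    rw [← mul_assoc, inv_mul_cancel₀ (by positivity), one_mul]
  | cons α as ih =>
    simp only [List.cons_append, extract, ← Multiset.sum_map_mul_left]
    rw [Finset.sum, Multiset.sum_map_sum_map]
    refine congrArg Multiset.sum (Multiset.map_congr rfl fun t _ => ?_)
    rw [← ih (s.erase t) ((Multiset.card_le_card (Multiset.erase_le t s)).trans hs),
      Finset.mul_sum, Finset.sum]
    refine congrArg Multiset.sum (Multiset.map_congr rfl fun k _ => ?_)
    ring

section

variable {ι A B : Type*} [Fintype ι] [CommRing A] [Algebra ℝ A] [CommRing B] [Algebra ℝ B]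

/-- The elements `F t` satisfy the recursion of the elementary differentials of `f`. -/
def IsElementary (D : ι → Derivation ℝ A A) (f : ι → A) (F : RTree → ι → A) : Prop :=
  ∀ (us : List RTree) (j : ι), F (RTree.node us) j = jet D LinearMap.id (us.map F) (f j)

/-- The sum `∑ ε ^ |t| α(t) / σ(t) F(t)` over the trees with at most `K` nodes. -/
def treeSum (ev : A →ₐ[ℝ] B) (F : RTree → ι → A) (ε : B) (K : ℕ) (α : RTree → ℝ) : ι → B :=
  fun j => ∑ t ∈ treesLE K,
    (ε ^ t.order * algebraMap ℝ B (α t / t.symmetryFactor)) * ev (F t j)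

variable {D : ι → Derivation ℝ A A} {f : ι → A} {F : RTree → ι → A}

/-- By multilinearity one direction is expanded into single trees `t`, each of which moves to `rs`.
The pairs of `t` and a remaining forest are then regrouped by their union; the number of ways to
single out `t` there cancels the factor in `symmetryFactor_cons`. -/
theorem jet_treeSum (hF : IsElementary D f F) (ev : A →ₐ[ℝ] B) {ε : B} {K : ℕ}
    (hε : ε ^ (K + 1) = 0) (as : List (RTree → ℝ)) (rs : List RTree) (j : ι) :
    jet D ev.toLinearMap
      (rs.map (fun t i => ev (F t i)) ++ as.map (treeSum ev F ε K)) (f j) =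
      ∑ s ∈ forestsLE K, (ε ^ (s.map RTree.order).sum *
        algebraMap ℝ B (extract 0 as s / (RTree.node s).symmetryFactor)) *
          ev (F (RTree.node (rs + s)) j) := by
  classical
  induction as generalizing rs with
  | nil =>
    rw [Finset.sum_eq_single 0]
    · have h : extract 0 [] 0 / ((RTree.node 0).symmetryFactor : ℝ) = 1 := by
        simp [extract, RTree.symmetryFactor_node]
      rw [h, map_one, add_zero, hF, map_jet_id, List.map_map]
      simp [Function.comp_def]
    · intro s _ hs
      obtain ⟨t, ht⟩ := Multiset.exists_mem_of_ne_zero hs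
      have h : extract 0 [] s = 0 := Multiset.prod_eq_zero (Multiset.mem_map.2 ⟨t, ht, rfl⟩)
      simp [h]
    · intro h
      exact absurd (mem_forestsLE.2 (by simp)) h
  | cons α as ih =>
    rw [List.map_cons]
    have hexp := jet_append_sum D ev.toLinearMap (rs.map fun t i => ev (F t i))
      (as.map (treeSum ev F ε K)) (treesLE K)
      (fun t => ε ^ t.order * algebraMap ℝ B (α t / t.symmetryFactor)) (fun t i => ev (F t i)) (f j)
    refine hexp.trans ?_
    have hterm : ∀ t, jet D ev.toLinearMap (rs.map (fun t i => ev (F t i)) ++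
        (fun i => ev (F t i)) :: as.map (treeSum ev F ε K)) (f j) =
        ∑ s ∈ forestsLE K, (ε ^ (s.map RTree.order).sum *
          algebraMap ℝ B (extract 0 as s / (RTree.node s).symmetryFactor)) *
            ev (F (RTree.node (rs + t ::ₘ s)) j) := by
      intro t
      have := ih (rs ++ [t])
      rw [List.map_append, List.append_assoc] at this
      refine this.trans (Finset.sum_congr rfl fun s _ => ?_)
      rw [← Multiset.coe_add, Multiset.coe_singleton, add_assoc, Multiset.singleton_add]
    simp only [hterm, Finset.mul_sum]
    have hr : ∀ s : Multiset RTree, (ε ^ (s.map RTree.order).sum *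
        algebraMap ℝ B (extract 0 (α :: as) s / (RTree.node s).symmetryFactor)) *
          ev (F (RTree.node (rs + s)) j) =
        ∑ t ∈ s.toFinset, (ε ^ t.order * algebraMap ℝ B (α t / t.symmetryFactor)) *
          ((ε ^ ((s.erase t).map RTree.order).sum * algebraMap ℝ B
            (extract 0 as (s.erase t) / (RTree.node (s.erase t)).symmetryFactor)) *
              ev (F (RTree.node (rs + t ::ₘ s.erase t)) j)) := by
      intro s
      rw [extract_cons_eq_sum, Finset.sum_div, map_sum, Finset.mul_sum, Finset.sum_mul]
      refine Finset.sum_congr rfl fun t ht => ?_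
      rw [Multiset.mem_toFinset] at ht
      obtain ⟨s', rfl⟩ := Multiset.exists_cons_of_mem ht
      have h1 : (t.symmetryFactor : ℝ) ≠ 0 := by exact_mod_cast (symmetryFactor_pos t).ne'
      have h2 : ((RTree.node s').symmetryFactor : ℝ) ≠ 0 := by
        exact_mod_cast (symmetryFactor_pos _).ne'
      have hc : (((t ::ₘ s').count t : ℝ) * (α t * extract 0 as s') /
          (((s'.count t + 1) * t.symmetryFactor * (RTree.node s').symmetryFactor : ℕ) : ℝ)) =
          (α t / t.symmetryFactor) * (extract 0 as s' / (RTree.node s').symmetryFactor) := by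
        rw [Multiset.count_cons_self]
        push_cast
        have h3 : ((s'.count t : ℝ) + 1) ≠ 0 := by positivity
        field_simp
      rw [Multiset.erase_cons_head, symmetryFactor_cons, hc, Multiset.map_cons, Multiset.sum_cons,
        pow_add, map_mul]
      ring
    rw [Finset.sum_congr rfl fun s _ => hr s, ← Finset.sum_product', Finset.sum_sigma']
    symm
    -- Pairs whose union has more than `K` nodes have no counterpart among the forests, but their
    -- terms vanish by nilpotency; hence only nonzero terms are matched.
    refine Finset.sum_bij_ne_zero (fun x _ _ => (x.2, x.1.erase x.2)) ?_ ?_ ?_ ?_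
    · rintro ⟨s, t⟩ hx _
      rw [Finset.mem_sigma, mem_forestsLE, Multiset.mem_toFinset] at hx
      obtain ⟨s', hs'⟩ := Multiset.exists_cons_of_mem hx.2
      change s = t ::ₘ s' at hs'
      subst hs'
      have := hx.1
      simp only [Multiset.map_cons, Multiset.sum_cons] at this
      simp only [Finset.mem_product, mem_treesLE, mem_forestsLE, Multiset.erase_cons_head]
      omega
    · rintro ⟨s, t⟩ hx _ ⟨s', t'⟩ hx' _ h
      rw [Finset.mem_sigma, Multiset.mem_toFinset] at hx hx'
      simp only [Prod.mk.injEq] at h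
      obtain ⟨rfl, h⟩ := h
      have : s = s' := by
        exact (Multiset.cons_erase hx.2).symm.trans
          ((congrArg (t ::ₘ ·) h).trans (Multiset.cons_erase hx'.2))
      subst this
      rfl
    · rintro ⟨t, s⟩ _ hne
      refine ⟨⟨t ::ₘ s, t⟩, ?_, ?_, ?_⟩
      · rw [Finset.mem_sigma, mem_forestsLE]
        refine ⟨?_, by simp⟩
        by_contra h
        refine hne ?_
        simp only [Multiset.map_cons, Multiset.sum_cons] at h
        have h0 : ε ^ t.order * ε ^ (s.map RTree.order).sum = 0 := by
          rw [← pow_add]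
          exact pow_eq_zero_of_le (by omega) hε
        calc _ = (ε ^ t.order * ε ^ (s.map RTree.order).sum) * _ := by
              simp only [mul_assoc]
              rw [mul_left_comm (algebraMap ℝ B _)]
          _ = 0 := by rw [h0, zero_mul]
      · simpa using hne
      · simp
    · rintro ⟨s, t⟩ _ _
      rfl

omit [Fintype ι] in
theorem treeSum_eq_mul (ev : A →ₐ[ℝ] B) (F : RTree → ι → A) (ε : B) (K : ℕ) (α : RTree → ℝ) :
    treeSum ev F ε K α = fun j => ε * ∑ t ∈ treesLE K,
      (ε ^ (t.order - 1) * algebraMap ℝ B (α t / t.symmetryFactor)) * ev (F t j) := by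
  funext j
  rw [treeSum, Finset.mul_sum]
  refine Finset.sum_congr rfl fun t _ => ?_
  rw [← mul_assoc, ← mul_assoc, ← pow_succ', Nat.sub_add_cancel (RTree.order_pos t)]

/-- The factor `ε ^ |u|` cannot be divided out in `B`. In the induction it splits into one `ε` for
the root and one power for each subtree, which makes every direction `T(F(uᵢ))` a `treeSum`.
`jet_treeSum` expands the resulting jets, the sum over Taylor orders replaces evaluation at zero by
evaluation at `φ`, and `taylorCoeff_node` identifies the coefficients. -/
theorem pow_order_mul_taylor (hF : IsElementary D f F) (ev : A →ₐ[ℝ] B) {ε : B} {K : ℕ}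
    (hε : ε ^ (K + 1) = 0) (φ : Character) (u : RTree) (j : ι) :
    ε ^ u.order * taylor D ev.toLinearMap (treeSum ev F ε K fun t => φ (tree t)) K (F u j) =
      treeSum ev F ε K (taylorCoeff φ u) j := by
  classical
  set δ := treeSum ev F ε K fun t => φ (tree t) with hδ
  -- Every tree has a node, so one `ε` factors out of `δ`; this is the nilpotency that
  -- multiplicativity of the Taylor operator requires.
  obtain ⟨T, hT⟩ : ∃ T : A →ₐ[ℝ] B, T.toLinearMap = taylor D ev.toLinearMap δ K := by
    rw [hδ, treeSum_eq_mul]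
    exact ⟨taylorHom D ev hε _, rfl⟩
  have hT' : ∀ x, taylor D ev.toLinearMap δ K x = T x := fun x => by rw [← hT]; rfl
  rw [hT']
  induction u using RTree.ind generalizing j with
  | h s ih =>
    obtain ⟨us, rfl⟩ := Quot.exists_rep s
    change ∀ t ∈ (us : Multiset RTree), _ at ih
    change ε ^ (RTree.node (us : Multiset RTree)).order * T (F (RTree.node (us : Multiset RTree)) j)
      = treeSum ev F ε K (taylorCoeff φ (RTree.node (us : Multiset RTree))) j
    have hmap : us.map (fun u i => ε ^ u.order * T (F u i)) =
        (us.map (taylorCoeff φ)).map (treeSum ev F ε K) := by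
      rw [List.map_map]
      exact List.map_congr_left fun u hu => funext fun i => ih u hu i
    have hprod : (us.map fun u => ε ^ u.order).prod =
        ε ^ (Multiset.map RTree.order (us : Multiset RTree)).sum := by
      clear * -
      induction us with
      | nil => simp
      | cons u us ih => simp_all [pow_add]
    rw [hF, map_jet_id, hT, jet_taylor, RTree.order_node, pow_add, pow_one, mul_assoc, ← hprod,
      Finset.mul_sum, List.map_map]
    have hstep : ∀ k, (us.map fun u => ε ^ u.order).prod * ((k.factorial : ℝ)⁻¹ •
        jet D ev.toLinearMap (us.map ((fun w i => T (w i)) ∘ F) ++ List.replicate k δ) (f j)) =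
        ∑ s ∈ forestsLE K, algebraMap ℝ B (((k.factorial : ℝ)⁻¹) * extract 0 (us.map (taylorCoeff φ) ++
            List.replicate k fun t => φ (tree t)) s) * (ε ^ (s.map RTree.order).sum *
          algebraMap ℝ B (1 / (RTree.node s).symmetryFactor) * ev (F (RTree.node s) j)) := by
      intro k
      rw [mul_smul_comm]
      have h1 := jet_map_smul D ev.toLinearMap us (fun u => ε ^ u.order) (fun u i => T (F u i))
        (List.replicate k δ) (f j)
      have h2 := jet_treeSum hF ev hε (us.map (taylorCoeff φ) ++
            List.replicate k fun t => φ (tree t)) [] j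
      rw [hmap] at h1
      rw [List.map_append, List.map_replicate, ← hδ, List.map_nil, List.nil_append, h1] at h2
      refine (congrArg _ h2).trans ?_
      rw [Finset.smul_sum]
      refine Finset.sum_congr rfl fun s _ => ?_
      rw [Algebra.smul_def, Multiset.coe_nil, zero_add, map_mul, div_eq_mul_one_div, map_mul]
      ring
    rw [Finset.sum_congr rfl fun k _ => hstep k, Finset.sum_comm, Finset.mul_sum]
    have hres : ∀ s ∈ forestsLE K, ε * ∑ k ∈ Finset.range (K + 1),
        algebraMap ℝ B (((k.factorial : ℝ)⁻¹) * extract 0 (us.map (taylorCoeff φ) ++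
            List.replicate k fun t => φ (tree t)) s) * (ε ^ (s.map RTree.order).sum *
          algebraMap ℝ B (1 / (RTree.node s).symmetryFactor) * ev (F (RTree.node s) j)) =
        (ε ^ (RTree.node s).order * algebraMap ℝ B (taylorCoeff φ (RTree.node us) (RTree.node s) /
          (RTree.node s).symmetryFactor)) * ev (F (RTree.node s) j) := by
      intro s hs
      rw [← Finset.sum_mul, ← map_sum, sum_extract_zero _ _ _ _
        ((card_le_sum_order s).trans (mem_forestsLE.1 hs)), ← taylorCoeff_node, RTree.order_node,
        pow_add, div_eq_mul_one_div (taylorCoeff _ _ _), map_mul]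
      ring
    rw [Finset.sum_congr rfl hres, forestsLE, Finset.sum_map, treeSum]
    simp only [Function.Embedding.coeFn_mk, RTree.node_children]
    symm
    -- Forests with at most `K` nodes correspond to trees with at most `K + 1` nodes; those with
    -- exactly `K + 1` drop out.
    refine Finset.sum_subset (fun t ht => mem_treesLE.2 ((mem_treesLE.1 ht).trans K.le_succ)) ?_
    intro t _ ht
    rw [mem_treesLE, not_le] at ht
    rw [pow_eq_zero_of_le (Nat.succ_le_of_lt ht) hε, zero_mul, zero_mul]

end

/-! ### Smooth functions and elementary differentials -/

/-- The algebra of smooth functions on `ℝᴺ`. -/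
def smoothAlgebra (N : ℕ) : Subalgebra ℝ ((Fin N → ℝ) → ℝ) where
  carrier := {g | ContDiff ℝ ∞ g}
  mul_mem' := by
    intro a b ha hb
    rw [Set.mem_ofPred_eq] at *
    exact ha.mul hb
  add_mem' := by
    intro a b ha hb
    rw [Set.mem_ofPred_eq] at *
    exact ha.add hb
  algebraMap_mem' := by
    intro r
    rw [Set.mem_ofPred_eq]
    exact contDiff_const

variable {N : ℕ}

theorem smoothAlgebra.contDiff (g : smoothAlgebra N) : ContDiff ℝ ∞ (g : (Fin N → ℝ) → ℝ) := g.2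

theorem smoothAlgebra.differentiable (g : smoothAlgebra N) :
    Differentiable ℝ (g : (Fin N → ℝ) → ℝ) :=
  (smoothAlgebra.contDiff g).differentiable (by simp)

/-- The partial derivatives of smooth functions. -/
def partialDeriv (i : Fin N) : Derivation ℝ (smoothAlgebra N) (smoothAlgebra N) :=
  Derivation.mk'
    { toFun := fun g => ⟨fun y => fderiv ℝ (g : (Fin N → ℝ) → ℝ) y (Pi.single i 1),
        ((smoothAlgebra.contDiff g).fderiv_right (m := ∞) (by norm_cast)).clm_apply
          contDiff_const⟩
      map_add' := fun g g' => Subtype.ext <| funext fun y => by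
        have := fderiv_add (smoothAlgebra.differentiable g y) (smoothAlgebra.differentiable g' y)
        exact DFunLike.congr_fun this (Pi.single i 1)
      map_smul' := fun c g => Subtype.ext <| funext fun y => by
        have := fderiv_const_smul (smoothAlgebra.differentiable g y) c
        exact DFunLike.congr_fun this (Pi.single i 1) }
    fun g g' => Subtype.ext <| funext fun y => by
      have := fderiv_mul (smoothAlgebra.differentiable g y) (smoothAlgebra.differentiable g' y)
      exact DFunLike.congr_fun this (Pi.single i 1)

theorem partialDeriv_apply (i : Fin N) (g : smoothAlgebra N) (y : Fin N → ℝ) :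
    (partialDeriv i g : (Fin N → ℝ) → ℝ) y =
      fderiv ℝ (g : (Fin N → ℝ) → ℝ) y (Pi.single i 1) := rfl

/-- Evaluation of smooth functions at a point. -/
def evalAt (y : Fin N → ℝ) : smoothAlgebra N →ₐ[ℝ] ℝ :=
  (Pi.evalAlgHom ℝ (fun _ : Fin N → ℝ => ℝ) y).comp (smoothAlgebra N).val

@[simp] theorem evalAt_apply (y : Fin N → ℝ) (g : smoothAlgebra N) :
    evalAt y g = (g : (Fin N → ℝ) → ℝ) y := rfl

theorem sum_mul_partialDeriv (g : smoothAlgebra N) (y a : Fin N → ℝ) :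
    ∑ i, a i * (partialDeriv i g : (Fin N → ℝ) → ℝ) y = fderiv ℝ (g : (Fin N → ℝ) → ℝ) y a := by
  conv_rhs => rw [pi_eq_sum_univ' a, map_sum]
  refine Finset.sum_congr rfl fun i _ => ?_
  rw [partialDeriv_apply, map_smul, smul_eq_mul]
/-- The derivative at `y` in the directions of a list of real vectors. -/
def realJet (y : Fin N → ℝ) (ws : List (Fin N → ℝ)) (g : smoothAlgebra N) : ℝ :=
  jet (partialDeriv (N := N)) (evalAt y).toLinearMap ws g

theorem realJet_nil (y : Fin N → ℝ) (g : smoothAlgebra N) :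
    realJet y [] g = (g : (Fin N → ℝ) → ℝ) y := rfl

theorem realJet_cons (y w : Fin N → ℝ) (ws : List (Fin N → ℝ)) (g : smoothAlgebra N) :
    realJet y (w :: ws) g = ∑ i, w i * realJet y ws (partialDeriv i g) :=
  jet_cons _ _ _ _ _

/-- The directional derivatives in constant directions, as a smooth function. -/
theorem jet_evalAt_const (ws : List (Fin N → ℝ)) (g : smoothAlgebra N) (y : Fin N → ℝ) :
    realJet y ws g =
      (jet (partialDeriv (N := N)) LinearMap.id
        (ws.map fun w i => algebraMap ℝ (smoothAlgebra N) (w i)) g : (Fin N → ℝ) → ℝ) y := by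
  rw [← evalAt_apply, map_jet_id, List.map_map, realJet]
  congr 2
  simp [Function.comp_def]

/-- The head of the list differentiates `g` first, so an appended direction is the outermost
derivative. -/
theorem jet_append_singleton (ws : List (Fin N → ℝ)) (a : Fin N → ℝ) (g : smoothAlgebra N)
    (y : Fin N → ℝ) :
    realJet y (ws ++ [a]) g =
      fderiv ℝ (fun z => realJet z ws g) y a := by
  induction ws generalizing g with
  | nil =>
    rw [List.nil_append, realJet_cons]
    exact sum_mul_partialDeriv g y a
  | cons w ws ih =>
    have hd : ∀ i, DifferentiableAt ℝ
        (fun z => realJet z ws (partialDeriv i g)) y := by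
      intro i
      rw [funext fun z => jet_evalAt_const ws (partialDeriv i g) z]
      exact smoothAlgebra.differentiable _ y
    have hfun : (fun z => realJet z (w :: ws) g) = fun z =>
        ∑ i, w i * realJet z ws (partialDeriv i g) :=
      funext fun z => realJet_cons _ _ _ _
    have hder : HasFDerivAt (fun z => ∑ i,
        w i * realJet z ws (partialDeriv i g))
        (∑ i, w i • fderiv ℝ
          (fun z => realJet z ws (partialDeriv i g)) y) y :=
      HasFDerivAt.fun_sum fun i _ => (hd i).hasFDerivAt.const_mul (w i)
    rw [hfun, hder.fderiv, List.cons_append, realJet_cons, sum_apply]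
    exact Finset.sum_congr rfl fun i _ => by rw [ih]; rfl

/-- The list is reversed because the first argument of `iteratedFDeriv` belongs to the outermost
derivative, whereas the head of a jet belongs to the innermost. -/
theorem iteratedFDeriv_eq_jet (l : List (Fin N → ℝ)) (g : smoothAlgebra N) (y : Fin N → ℝ) :
    iteratedFDeriv ℝ l.length (g : (Fin N → ℝ) → ℝ) y l.get =
      realJet y l.reverse g := by
  induction l generalizing y with
  | nil => simp [realJet_nil]
  | cons a l ih =>
    have hd : DifferentiableAt ℝ (iteratedFDeriv ℝ l.length (g : (Fin N → ℝ) → ℝ)) y :=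
      (smoothAlgebra.contDiff g).differentiable_iteratedFDeriv
        (by exact_mod_cast WithTop.coe_lt_top _) y
    rw [List.reverse_cons, jet_append_singleton, ← funext fun z => ih z,
      fderiv_continuousMultilinear_apply_const_apply hd]
    rfl

/-- The components of a smooth map. -/
def component (f : SmoothField N) (j : Fin N) : smoothAlgebra N :=
  ⟨fun y => f.1 y j, contDiff_pi.1 f.2 j⟩

theorem iteratedFDeriv_component (f : SmoothField N) (j : Fin N) (l : List (Fin N → ℝ))
    (y : Fin N → ℝ) :
    iteratedFDeriv ℝ l.length f.1 y l.get j =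
      realJet y l.reverse (component f j) := by
  rw [← iteratedFDeriv_eq_jet]
  have := ContinuousLinearMap.iteratedFDeriv_comp_left
    (ContinuousLinearMap.proj (R := ℝ) (φ := fun _ : Fin N => ℝ) j)
    (f.2.contDiffAt (x := y)) (i := l.length) (by exact_mod_cast le_top)
  exact (DFunLike.congr_fun this l.get).symm

theorem iteratedFDeriv_map_get {α : Type} (f : SmoothField N) (l : List α)
    (g : α → (Fin N → ℝ)) (y : Fin N → ℝ) :
    iteratedFDeriv ℝ l.length f.1 y (fun i => g (l.get i)) =
      iteratedFDeriv ℝ (l.map g).length f.1 y (l.map g).get := by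
  have : ∀ (n : ℕ) (h : n = l.length) (v : Fin n → (Fin N → ℝ)),
      (∀ i, v i = g (l.get (Fin.cast h i))) →
      iteratedFDeriv ℝ n f.1 y v = iteratedFDeriv ℝ l.length f.1 y (fun i => g (l.get i)) := by
    rintro n rfl v hv
    exact congrArg _ (funext hv)
  exact (this _ (by simp) _ (by simp)).symm

theorem elementaryDifferential_eq_jet (f : SmoothField N) (us : List RTree) (y : Fin N → ℝ)
    (j : Fin N) :
    elementaryDifferential f.1 (RTree.node us) y j =
      realJet y
        (us.map fun t => elementaryDifferential f.1 t y) (component f j) := by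
  -- The children form a multiset, so reversing their list is free and undoes the reversal in the
  -- jet.
  rw [← Multiset.coe_reverse, elementaryDifferential_node f.2,
    iteratedFDeriv_map_get f us.reverse fun t => elementaryDifferential f.1 t y,
    iteratedFDeriv_component, List.map_reverse, List.reverse_reverse]

theorem contDiff_elementaryDifferential (f : SmoothField N) (t : RTree) :
    ContDiff ℝ ∞ (elementaryDifferential f.1 t) := by
  classical
  induction t using RTree.ind with
  | h s ih =>
    obtain ⟨us, rfl⟩ := Quot.exists_rep s
    change ∀ t ∈ (us : Multiset RTree), _ at ih
    change ContDiff ℝ ∞ (elementaryDifferential f.1 (RTree.node (us : Multiset RTree)))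
    -- Smoothness is known only for the trees in `us`, so the total function takes the value `0`
    -- wherever it is not available.
    let G : RTree → Fin N → smoothAlgebra N := fun t i =>
      if h : ContDiff ℝ ∞ (elementaryDifferential f.1 t) then component ⟨_, h⟩ i else 0
    refine contDiff_pi.2 fun j => ?_
    have : (fun y => elementaryDifferential f.1 (RTree.node (us : Multiset RTree)) y j) =
        (jet (partialDeriv (N := N)) LinearMap.id (us.map G) (component f j) : smoothAlgebra N) := by
      funext y
      rw [elementaryDifferential_eq_jet, realJet, ← evalAt_apply, map_jet_id, List.map_map]
      congr 2
      refine List.map_congr_left fun t ht => funext fun i => ?_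
      simp only [Function.comp_apply, G]
      rw [dif_pos (ih t ht)]
      rfl
    rw [this]
    exact smoothAlgebra.contDiff _

/-- The components of the elementary differentials, as smooth functions. -/
def smoothElementary (f : SmoothField N) (t : RTree) (j : Fin N) : smoothAlgebra N :=
  component ⟨elementaryDifferential f.1 t, contDiff_elementaryDifferential f t⟩ j

theorem isElementary_smoothElementary (f : SmoothField N) :
    IsElementary partialDeriv (component f) (smoothElementary f) := by
  intro us j
  refine Subtype.ext <| funext fun y => ?_
  refine (elementaryDifferential_eq_jet f us y j).trans ?_
  rw [← evalAt_apply, map_jet_id, List.map_map]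
  rfl

/-! ### Substitution coefficients -/

theorem blocks_composition_zero (c : Composition 0) : c.blocks = [] :=
  List.length_eq_zero_iff.1 (Nat.le_zero.1 c.length_le)

/-- The last block `m + 1` is split off rather than the first, because the jets run through the
blocks in reverse order. -/
theorem sum_composition_succ {M : Type*} [AddCommMonoid M] (n : ℕ) (Q : List ℕ → M) :
    ∑ c : Composition (n + 1), Q c.blocks =
      ∑ m ∈ Finset.range (n + 1), ∑ c : Composition (n - m), Q (c.blocks ++ [m + 1]) := by
  rw [Finset.sum_sigma']
  symm
  refine Finset.sum_bij (fun x hx => ⟨x.2.blocks ++ [x.1 + 1], ?_, ?_⟩) ?_ ?_ ?_ ?_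
  · intro i hi
    rcases List.mem_append.1 hi with h | h
    · exact x.2.blocks_pos h
    · rw [List.mem_singleton.1 h]; omega
  · rw [List.sum_append, x.2.blocks_sum, List.sum_singleton]
    have := Finset.mem_range.1 (Finset.mem_sigma.1 hx).1
    omega
  · intro _ _
    exact Finset.mem_univ _
  · rintro ⟨m, c⟩ _ ⟨m', c'⟩ _ h
    have h' := congrArg Composition.blocks h
    obtain ⟨h1, h2⟩ := List.append_inj' h' rfl
    simp only [List.cons.injEq, Nat.add_right_cancel_iff, and_true] at h2
    subst h2
    exact congrArg (Sigma.mk m) (Composition.ext h1)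
  · rintro c _
    rcases List.eq_nil_or_concat c.blocks with h | ⟨l, b, h⟩
    · have := c.blocks_sum
      simp [h] at this
    · have hb : 0 < b := c.blocks_pos (by rw [h]; simp)
      have hs := c.blocks_sum
      rw [h, List.concat_eq_append, List.sum_append, List.sum_singleton] at hs
      refine ⟨⟨b - 1, ⟨l, fun hi => c.blocks_pos (by rw [h]; simp [hi]), by omega⟩⟩, ?_, ?_⟩
      · rw [Finset.mem_sigma, Finset.mem_range]
        refine ⟨?_, Finset.mem_univ _⟩
        change b - 1 < n + 1
        omega
      · refine Composition.ext ?_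
        simp only [h, List.concat_eq_append]
        rw [Nat.sub_add_cancel hb]
  · rintro _ _
    rfl

section

variable {B : Type*} [CommRing B] [Algebra ℝ B]

omit [Algebra ℝ B] in
theorem sum_range_mul_sum_range {ε : B} {K : ℕ} (hε : ε ^ (K + 1) = 0) (X : ℕ → ℕ → B) :
    ∑ m ∈ Finset.range K, ∑ q ∈ Finset.range (K + 1), ε ^ (m + 1) * (ε ^ q * X m q) =
      ∑ n ∈ Finset.range K, ∑ m ∈ Finset.range (n + 1), ε ^ (n + 1) * X m (n - m) := by
  have h := Finset.sum_range_diag_flip K fun m q => ε ^ (m + q + 1) * X m q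
  rw [Finset.sum_congr rfl fun n _ => Finset.sum_congr rfl fun m hm => by
    rw [Nat.add_sub_cancel' (Nat.lt_succ_iff.1 (Finset.mem_range.1 hm))]] at h
  rw [h]
  refine Finset.sum_congr rfl fun m _ => ?_
  symm
  have e : ∀ q, ε ^ (m + q + 1) * X m q = ε ^ (m + 1) * (ε ^ q * X m q) := fun q => by ring
  simp only [e]
  refine Finset.sum_subset (Finset.range_mono (by omega)) fun q _ hq => ?_
  rw [← e, pow_eq_zero_of_le (by simp at hq; omega) hε, zero_mul]

/-- Expanding `k` copies of the increment chooses a positive exponent for each of them, and these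
choices are the compositions with `k` blocks. -/
theorem jet_replicate_curve {ε : B} {K : ℕ} (hε : ε ^ (K + 1) = 0) (y : Fin N → ℝ)
    (a : ℕ → Fin N → ℝ) (k : ℕ) (g : smoothAlgebra N) :
    jet (partialDeriv (N := N)) ((Algebra.ofId ℝ B).comp (evalAt y)).toLinearMap
      (List.replicate k fun i => ∑ m ∈ Finset.range K, ε ^ (m + 1) * algebraMap ℝ B (a (m + 1) i)) g =
    ∑ n ∈ Finset.range (K + 1), ε ^ n * algebraMap ℝ B (∑ c : Composition n,
      if c.blocks.length = k then
        realJet y (c.blocks.map a).reverse g else 0) := by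
  induction k generalizing g with
  | zero =>
    rw [Finset.sum_range_succ', Finset.sum_eq_zero]
    · simp [blocks_composition_zero, Algebra.ofId_apply, composition_card, realJet_nil]
    · intro n _
      rw [sum_composition_succ n fun l : List ℕ => if l.length = 0 then
        realJet y (l.map a).reverse g else 0]
      simp
  | succ k ih =>
    rw [List.replicate_succ, jet_cons]
    simp only [ih]
    rw [Finset.sum_range_succ']
    have h0 : (∑ c : Composition 0, if c.blocks.length = k + 1 then
        realJet y (c.blocks.map a).reverse g else 0) = 0 := by
      refine Finset.sum_eq_zero fun c _ => ?_
      simp [blocks_composition_zero]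
    rw [h0, map_zero, mul_zero, add_zero]
    have hrec : ∀ n, (∑ c : Composition (n + 1), if c.blocks.length = k + 1 then
        realJet y (c.blocks.map a).reverse g else 0) =
        ∑ m ∈ Finset.range (n + 1), ∑ i, a (m + 1) i * ∑ c : Composition (n - m),
          if c.blocks.length = k then
            realJet y (c.blocks.map a).reverse (partialDeriv i g)
          else 0 := by
      intro n
      rw [sum_composition_succ n fun l : List ℕ => if l.length = k + 1 then
        realJet y (l.map a).reverse g else 0]
      refine Finset.sum_congr rfl fun m _ => ?_
      simp only [List.length_append, List.length_singleton, Nat.add_right_cancel_iff,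
        List.map_append, List.map_cons, List.map_nil, List.reverse_append, List.reverse_singleton,
        List.singleton_append, realJet_cons, Finset.mul_sum]
      rw [Finset.sum_comm]
      refine Finset.sum_congr rfl fun c _ => ?_
      split_ifs <;> simp
    obtain ⟨S, hS⟩ : ∃ S : ℕ → smoothAlgebra N → ℝ, ∀ n g, (∑ c : Composition n,
        if c.blocks.length = k then realJet y (c.blocks.map a).reverse g else 0) = S n g :=
      ⟨_, fun _ _ => rfl⟩
    simp only [hrec, hS, map_sum, map_mul]
    have hswap := sum_range_mul_sum_range hε fun m q => ∑ i,
      algebraMap ℝ B (a (m + 1) i) * algebraMap ℝ B (S q (partialDeriv i g))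
    simp only [← Finset.mul_sum] at hswap
    rw [← hswap]
    simp only [Finset.sum_mul, Finset.mul_sum]
    rw [Finset.sum_comm]
    refine (Finset.sum_congr rfl fun n _ => Finset.sum_comm).trans ?_
    rw [Finset.sum_comm]
    exact Finset.sum_congr rfl fun m _ => Finset.sum_congr rfl fun n _ =>
      Finset.sum_congr rfl fun i _ => by ring

/-- The Taylor expansion along a formal curve has the coefficients `substCoeff`. -/
theorem taylor_eq_sum_substCoeff {ε : B} {K : ℕ} (hε : ε ^ (K + 1) = 0) (g : SmoothField N)
    (Ψ : FormalMap N) (y : Fin N → ℝ) (hΨ : Ψ 0 y = y) (j : Fin N) :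
    taylor partialDeriv ((Algebra.ofId ℝ B).comp (evalAt y)).toLinearMap
      (fun i => ∑ m ∈ Finset.range K, ε ^ (m + 1) * algebraMap ℝ B (Ψ (m + 1) y i)) K
      (component g j) =
    ∑ n ∈ Finset.range (K + 1), ε ^ n * algebraMap ℝ B (FormalMap.substCoeff g.1 Ψ n y j) := by
  rw [taylor_apply]
  simp only [jet_replicate_curve hε y (fun m => Ψ m y), Finset.smul_sum]
  rw [Finset.sum_comm]
  refine Finset.sum_congr rfl fun n hn => ?_
  simp only [← mul_smul_comm]
  rw [← Finset.mul_sum]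
  congr 1
  simp only [Algebra.smul_def, ← map_mul, ← map_sum, Finset.mul_sum]
  congr 1
  rw [Finset.sum_comm, FormalMap.substCoeff, Finset.sum_apply]
  refine Finset.sum_congr rfl fun c _ => ?_
  have hlen : c.length ≤ K := c.length_le.trans (Nat.lt_succ_iff.1 (Finset.mem_range.1 hn))
  simp only [mul_ite, mul_zero]
  rw [Finset.sum_ite_eq, if_pos (Finset.mem_range.2 (Nat.lt_succ_of_le hlen)), hΨ, Pi.smul_apply,
    smul_eq_mul, ← iteratedFDeriv_component, ← iteratedFDeriv_map_get]
  rfl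

end

/-! ### Composition of B-series -/

theorem exists_nilpotent (K : ℕ) : ∃ (B : Type) (_ : CommRing B) (_ : Algebra ℝ B) (ε : B),
    ε ^ (K + 1) = 0 ∧ ∀ a b : ℕ → ℝ,
      ∑ n ∈ Finset.range (K + 1), ε ^ n * algebraMap ℝ B (a n) =
        ∑ n ∈ Finset.range (K + 1), ε ^ n * algebraMap ℝ B (b n) → ∀ n ≤ K, a n = b n := by
  refine ⟨Polynomial ℝ ⧸ Ideal.span {(Polynomial.X : Polynomial ℝ) ^ (K + 1)}, inferInstance,
    inferInstance, Ideal.Quotient.mk _ Polynomial.X, ?_, ?_⟩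
  · rw [← map_pow, Ideal.Quotient.eq_zero_iff_mem]
    exact Ideal.mem_span_singleton_self _
  · intro a b h n hn
    have hq : ∀ c : ℕ → ℝ, ∑ n ∈ Finset.range (K + 1),
        Ideal.Quotient.mk (Ideal.span {(Polynomial.X : Polynomial ℝ) ^ (K + 1)}) Polynomial.X ^ n *
          algebraMap ℝ _ (c n) = Ideal.Quotient.mk _
            (∑ n ∈ Finset.range (K + 1), Polynomial.X ^ n * Polynomial.C (c n)) := by
      intro c
      simp only [map_sum, map_mul, map_pow]
      rfl
    rw [hq, hq, Ideal.Quotient.mk_eq_mk_iff_sub_mem, Ideal.mem_span_singleton,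
      Polynomial.X_pow_dvd_iff] at h
    have := h n (Nat.lt_succ_of_le hn)
    simp only [Polynomial.coeff_sub, Polynomial.finsetSum_coeff, Polynomial.coeff_X_pow_mul',
      Polynomial.coeff_C] at this
    have hs : ∀ c : ℕ → ℝ, (∑ x ∈ Finset.range (K + 1), if x ≤ n then
        (if n - x = 0 then c x else 0) else 0) = c n := by
      intro c
      rw [Finset.sum_eq_single n]
      · simp
      · intro m _ hm
        split_ifs with h1 h2
        · omega
        · rfl
        · rfl
      · intro h'
        exact absurd (Finset.mem_range.2 (Nat.lt_succ_of_le hn)) h'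
    rw [hs, hs] at this
    linarith

section

variable {B : Type*} [CommRing B] [Algebra ℝ B]

omit [Algebra ℝ B] in
theorem sum_antidiagonal_pow {ε : B} {K : ℕ} (hε : ε ^ (K + 1) = 0) (X : ℕ → ℕ → B) :
    ∑ n ∈ Finset.range (K + 1), ε ^ n * ∑ p ∈ Finset.HasAntidiagonal.antidiagonal n, X p.1 p.2 =
      ∑ p ∈ Finset.range (K + 1), ε ^ p * ∑ q ∈ Finset.range (K + 1), ε ^ q * X p q := by
  have h := Finset.sum_range_diag_flip (K + 1) fun m q => ε ^ (m + q) * X m q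
  simp only [Finset.Nat.sum_antidiagonal_eq_sum_range_succ X, Finset.mul_sum]
  rw [Finset.sum_congr rfl fun n _ => Finset.sum_congr rfl fun m hm => by
    rw [Nat.add_sub_cancel' (Nat.lt_succ_iff.1 (Finset.mem_range.1 hm))]] at h
  rw [h]
  refine Finset.sum_congr rfl fun m _ => ?_
  simp only [← mul_assoc, ← pow_add]
  refine Finset.sum_subset (Finset.range_mono (by omega)) fun q _ hq => ?_
  rw [pow_eq_zero_of_le (by simp at hq; omega) hε, zero_mul]

omit [Algebra ℝ B] in
theorem sum_treesLE (K : ℕ) (X : RTree → B) :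
    ∑ t ∈ treesLE K, X t = ∑ n ∈ Finset.range K, ∑ t ∈ RTree.ofOrder (n + 1), X t := by
  have h : ∑ t ∈ treesLE K, X t =
      ∑ n ∈ Finset.range (K + 1), ∑ t ∈ treesLE K with t.order = n, X t :=
    (Finset.sum_fiberwise_of_maps_to (fun t ht =>
      Finset.mem_range.2 (Nat.lt_succ_of_le (mem_treesLE.1 ht))) X).symm
  rw [h, Finset.sum_range_succ']
  have h0 : ∑ t ∈ treesLE K with t.order = 0, X t = 0 := by
    refine Finset.sum_eq_zero fun t ht => ?_
    have := (Finset.mem_filter.1 ht).2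
    have := RTree.order_pos t
    omega
  rw [h0, add_zero]
  refine Finset.sum_congr rfl fun n hn => Finset.sum_congr ?_ fun _ _ => rfl
  ext t
  have := Finset.mem_range.1 hn
  simp only [Finset.mem_filter, mem_treesLE, RTree.mem_ofOrder]
  omega

theorem treeSum_eq_bSeries (f : SmoothField N) (y : Fin N → ℝ) (ε : B) (K : ℕ) (φ : Character)
    (j : Fin N) :
    treeSum ((Algebra.ofId ℝ B).comp (evalAt y)) (smoothElementary f) ε K
      (fun t => φ (tree t)) j =
    ∑ m ∈ Finset.range K, ε ^ (m + 1) * algebraMap ℝ B (bSeries φ N f (m + 1) y j) := by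
  rw [treeSum, sum_treesLE]
  refine Finset.sum_congr rfl fun m _ => ?_
  rw [bSeries, if_neg (Nat.succ_ne_zero m), Finset.sum_apply, map_sum, Finset.mul_sum]
  refine Finset.sum_congr rfl fun t ht => ?_
  rw [RTree.mem_ofOrder.1 ht, mul_assoc, Pi.smul_apply, smul_eq_mul, map_mul]
  rfl

theorem sum_range_bSeries (f : SmoothField N) (y : Fin N → ℝ) (ε : B) (K : ℕ) (φ : Character)
    (j : Fin N) :
    ∑ n ∈ Finset.range (K + 1), ε ^ n * algebraMap ℝ B (bSeries φ N f n y j) =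
    algebraMap ℝ B (y j) + treeSum ((Algebra.ofId ℝ B).comp (evalAt y)) (smoothElementary f) ε K
      (fun t => φ (tree t)) j := by
  rw [Finset.sum_range_succ', treeSum_eq_bSeries, add_comm]
  simp [bSeries]

end

theorem contDiff_bSeries (φ : Character) (f : SmoothField N) (n : ℕ) :
    ContDiff ℝ ∞ (bSeries φ N f n) := by
  by_cases h : n = 0
  · subst h
    exact contDiff_id
  · have : bSeries φ N f n = fun y => ∑ t ∈ RTree.ofOrder n,
        (φ (tree t) / (t.symmetryFactor : ℝ)) • elementaryDifferential f.1 t y := by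
      funext y
      rw [bSeries, if_neg h]
    rw [this]
    exact ContDiff.sum fun t _ => (contDiff_elementaryDifferential f t).const_smul _

theorem component_bSeries (φ : Character) (f : SmoothField N) (n : ℕ) (j : Fin N) :
    component ⟨bSeries φ N f (n + 1), contDiff_bSeries φ f (n + 1)⟩ j =
      ∑ t ∈ RTree.ofOrder (n + 1), (φ (tree t) / (t.symmetryFactor : ℝ)) • smoothElementary f t j := by
  refine Subtype.ext <| funext fun y => ?_
  rw [← evalAt_apply, ← evalAt_apply, map_sum]
  change bSeries φ N f (n + 1) y j = _
  rw [bSeries, if_neg (Nat.succ_ne_zero n), Finset.sum_apply]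
  exact Finset.sum_congr rfl fun t _ => by rw [map_smul]; rfl

theorem partialDeriv_component_id (i j : Fin N) :
    partialDeriv i (component ⟨fun y => y, contDiff_id⟩ j) =
      algebraMap ℝ (smoothAlgebra N) ((Pi.single i 1 : Fin N → ℝ) j) := by
  refine Subtype.ext <| funext fun y => ?_
  rw [partialDeriv_apply]
  change fderiv ℝ (fun y : Fin N → ℝ => y j) y (Pi.single i 1) = _
  rw [(hasFDerivAt_apply j y).fderiv]
  rfl

theorem component_bSeries_zero (φ : Character) (f : SmoothField N) (j : Fin N) :
    component ⟨bSeries φ N f 0, contDiff_bSeries φ f 0⟩ j =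
      component ⟨fun y => y, contDiff_id⟩ j := rfl

section

variable {B : Type*} [CommRing B] [Algebra ℝ B]

theorem taylor_component_id (y : Fin N → ℝ) {ε : B} {K : ℕ} (hε : ε ^ (K + 1) = 0)
    (δ : Fin N → B) (j : Fin N) :
    taylor (partialDeriv (N := N)) ((Algebra.ofId ℝ B).comp (evalAt y)).toLinearMap
      (fun i => ε * δ i) K (component ⟨fun y => y, contDiff_id⟩ j) =
      algebraMap ℝ B (y j) + ε * δ j := by
  set g : smoothAlgebra N := component ⟨fun y => y, contDiff_id⟩ j with hg
  set ev : smoothAlgebra N →ₐ[ℝ] B := (Algebra.ofId ℝ B).comp (evalAt y) with hev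
  have h0 : ev g = algebraMap ℝ B (y j) := rfl
  have h1 : jet (partialDeriv (N := N)) ev.toLinearMap [fun i => ε * δ i] g = ε * δ j := by
    rw [jet_cons, Finset.sum_eq_single j]
    · rw [hg, partialDeriv_component_id, Pi.single_eq_same, map_one, jet_nil]
      simp
    · intro i _ hi
      rw [hg, partialDeriv_component_id, Pi.single_eq_of_ne hi.symm, map_zero, map_zero, mul_zero]
    · intro h
      exact absurd (Finset.mem_univ j) h
  have h2 : ∀ k, jet (partialDeriv (N := N)) ev.toLinearMap
      (List.replicate (k + 2) fun i => ε * δ i) g = 0 := by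
    intro k
    rw [List.replicate_succ, jet_cons]
    refine Finset.sum_eq_zero fun i _ => ?_
    rw [hg, partialDeriv_component_id, Algebra.algebraMap_eq_smul_one, map_smul,
      jet_replicate_one, smul_zero, mul_zero]
  rw [taylor_apply]
  -- For `K = 0` the expansion has no linear term, but then `ε = 0` and so has the right-hand side.
  cases K with
  | zero =>
    have : ε = 0 := by simpa using hε
    subst this
    simp [h0]
  | succ K =>
    rw [Finset.sum_range_succ', Finset.sum_range_succ', Finset.sum_eq_zero fun k _ => by
      rw [h2, smul_zero]]
    simp [h0, h1, add_comm]

/-- The value of a character on a trunk, in terms of the coefficients of the trunk. -/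
theorem sum_mul_coeff_trunk (φ₁ φ₂ : Character) (t : RTree) (U : Finset RTree)
    (hU : ∀ c ∈ t.admCuts, c.1 ∈ U) :
    ∑ u ∈ U, φ₂ (tree u) * MvPolynomial.coeff (Finsupp.single u 1) (trunk φ₁ t) =
      φ₂ (trunk φ₁ t) := by
  classical
  unfold trunk
  generalize t.admCuts = s at hU
  induction s using Multiset.induction_on with
  | empty => simp
  | cons c s ih =>
    rw [Multiset.map_cons, Multiset.sum_cons, map_add,
      ← ih fun c' hc' => hU c' (Multiset.mem_cons_of_mem hc')]
    simp only [MvPolynomial.coeff_add, mul_add, Finset.sum_add_distrib]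
    congr 1
    rw [Finset.sum_eq_single c.1]
    · simp [tree, mul_comm]
    · intro u _ hu
      simp [tree, MvPolynomial.coeff_X, Finsupp.single_left_inj, hu.symm]
    · intro h
      exact absurd (hU c (Multiset.mem_cons_self c s)) h

/-- The value of `φ₁ * φ₂` on `t` is `φ₁(t)`, from the total cut, plus `φ₂` of the linear form
`trunk φ₁ t`. The factor `σ(u)` in `taylorCoeff` cancels the one of the outer B-series. -/
theorem treeSum_conv (F : RTree → Fin N → smoothAlgebra N) (ev : smoothAlgebra N →ₐ[ℝ] B)
    (ε : B) (K : ℕ) (φ₁ φ₂ : Character) (j : Fin N)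
    (hz : ∀ u, K < u.order → treeSum ev F ε K (taylorCoeff φ₁ u) j = 0) :
    treeSum ev F ε K (fun t => φ₁ (tree t)) j + ∑ u ∈ treesLE K,
      algebraMap ℝ B (φ₂ (tree u) / u.symmetryFactor) * treeSum ev F ε K (taylorCoeff φ₁ u) j =
      treeSum ev F ε K (fun t => conv φ₁ φ₂ (tree t)) j := by
  classical
  -- Enlarging the index set to contain every `R_c` avoids comparing the order of `R_c` with that of
  -- `t`; by `hz` the extra terms are zero.
  set U : Finset RTree := treesLE K ∪
    (treesLE K).biUnion fun t => (t.admCuts.map Prod.fst).toFinset with hU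
  have hsub : treesLE K ⊆ U := Finset.subset_union_left
  rw [Finset.sum_subset hsub fun u _ hu => by
    rw [mem_treesLE, not_le] at hu
    rw [hz u hu, mul_zero]]
  simp only [treeSum, Finset.mul_sum]
  rw [Finset.sum_comm, ← Finset.sum_add_distrib]
  refine Finset.sum_congr rfl fun t ht => ?_
  have hc : ∀ c ∈ t.admCuts, c.1 ∈ U := fun c hc => Finset.mem_union_right _
    (Finset.mem_biUnion.2 ⟨t, ht, Multiset.mem_toFinset.2 (Multiset.mem_map_of_mem _ hc)⟩)
  have hconv : conv φ₁ φ₂ (tree t) = φ₁ (tree t) + φ₂ (trunk φ₁ t) := by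
    rw [conv_apply, translate_tree, map_add, ← MvPolynomial.algebraMap_eq, AlgHom.commutes]
    rfl
  have hterm : ∀ u, algebraMap ℝ B (φ₂ (tree u) / u.symmetryFactor) *
      (ε ^ t.order * algebraMap ℝ B (taylorCoeff φ₁ u t / t.symmetryFactor) * ev (F t j)) =
      algebraMap ℝ B (φ₂ (tree u) * MvPolynomial.coeff (Finsupp.single u 1) (trunk φ₁ t)) *
        (ε ^ t.order * algebraMap ℝ B (1 / t.symmetryFactor) * ev (F t j)) := by
    intro u
    have hu : (u.symmetryFactor : ℝ) ≠ 0 := by exact_mod_cast (symmetryFactor_pos u).ne'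
    have : φ₂ (tree u) * MvPolynomial.coeff (Finsupp.single u 1) (trunk φ₁ t) =
        φ₂ (tree u) / u.symmetryFactor * taylorCoeff φ₁ u t := by
      rw [taylorCoeff]
      field_simp
    rw [this, div_eq_mul_one_div (taylorCoeff φ₁ u t), map_mul, map_mul]
    ring
  simp only [hterm]
  rw [← Finset.sum_mul, ← map_sum, sum_mul_coeff_trunk φ₁ φ₂ t U hc, hconv,
    div_eq_mul_one_div (φ₁ (tree t)), div_eq_mul_one_div (_ + _), map_mul, map_mul, map_add]
  ring

end

/-- The composition of two B-series is the B-series of the convolution product. -/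
theorem bSeries_comp (φ₁ φ₂ : Character) (f : SmoothField N) :
    (bSeries φ₂ N f).comp (bSeries φ₁ N f) = bSeries (conv φ₁ φ₂) N f := by
  funext K y j
  -- The index of the coefficient to be compared serves as the truncation order.
  obtain ⟨B, _, _, ε, hε, hinj⟩ := exists_nilpotent K
  refine hinj (fun n => (bSeries φ₂ N f).comp (bSeries φ₁ N f) n y j)
    (fun n => bSeries (conv φ₁ φ₂) N f n y j) ?_ K le_rfl
  set ev : smoothAlgebra N →ₐ[ℝ] B := (Algebra.ofId ℝ B).comp (evalAt y) with hev
  set F := smoothElementary f with hF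
  set δ := treeSum ev F ε K (fun t => φ₁ (tree t)) with hδ
  have hmain := fun u j => pow_order_mul_taylor (isElementary_smoothElementary f) ev hε φ₁ u j
  have hcurve : δ = fun i => ∑ m ∈ Finset.range K,
      ε ^ (m + 1) * algebraMap ℝ B (bSeries φ₁ N f (m + 1) y i) :=
    funext fun i => treeSum_eq_bSeries f y ε K φ₁ i
  have hT : ∀ p, ∑ q ∈ Finset.range (K + 1), ε ^ q * algebraMap ℝ B
      (FormalMap.substCoeff (bSeries φ₂ N f p) (bSeries φ₁ N f) q y j) =
      taylor (partialDeriv (N := N)) ev.toLinearMap δ K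
        (component ⟨bSeries φ₂ N f p, contDiff_bSeries φ₂ f p⟩ j) := by
    intro p
    rw [hcurve]
    exact (taylor_eq_sum_substCoeff hε ⟨bSeries φ₂ N f p, contDiff_bSeries φ₂ f p⟩
      (bSeries φ₁ N f) y (by simp [bSeries]) j).symm
  have hcomp : ∀ n, algebraMap ℝ B ((bSeries φ₂ N f).comp (bSeries φ₁ N f) n y j) =
      ∑ p ∈ Finset.HasAntidiagonal.antidiagonal n, algebraMap ℝ B
        (FormalMap.substCoeff (bSeries φ₂ N f p.1) (bSeries φ₁ N f) p.2 y j) := by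
    intro n
    rw [FormalMap.comp, Finset.sum_apply, map_sum]
  simp only [hcomp]
  rw [sum_antidiagonal_pow hε fun p q => algebraMap ℝ B
    (FormalMap.substCoeff (bSeries φ₂ N f p) (bSeries φ₁ N f) q y j)]
  simp only [hT]
  rw [sum_range_bSeries, ← hev, ← hF, ← treeSum_conv F ev ε K φ₁ φ₂ j fun u hu => by
    rw [← hmain, pow_eq_zero_of_le (Nat.succ_le_of_lt hu) hε, zero_mul]]
  -- The coefficient of `h⁰` of the outer series is the identity map, whose expansion is `y + δ`; it
  -- supplies the contribution of the total cuts.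
  rw [Finset.sum_range_succ', pow_zero, one_mul, sum_treesLE, add_comm, ← add_assoc]
  congr 1
  · rw [hδ, treeSum_eq_mul, component_bSeries_zero]
    exact taylor_component_id y hε _ j
  · refine Finset.sum_congr rfl fun p _ => ?_
    rw [component_bSeries, map_sum, Finset.mul_sum]
    refine Finset.sum_congr rfl fun t ht => ?_
    rw [map_smul, mul_smul_comm, ← RTree.mem_ofOrder.1 ht, hδ, hmain, Algebra.smul_def]

/-! ### Independence of the elementary differentials -/

section Separation

variable (idx : Fin N → RTree)

open Classical in
/-- The coordinate function with index `s`. -/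
def treeCoord (s : RTree) : smoothAlgebra N :=
  ∑ i, if idx i = s then component ⟨fun y => y, contDiff_id⟩ i else 0

/-- The vector field whose component with index `t` is the product of the coordinates whose indices
are the subtrees attached to the root of `t`. -/
def treeField : SmoothField N :=
  ⟨fun y j => ((((idx j).children.map (treeCoord idx)).prod : smoothAlgebra N) :
      (Fin N → ℝ) → ℝ) y,
    contDiff_pi.2 fun _ => smoothAlgebra.contDiff _⟩

theorem component_treeField (j : Fin N) :
    component (treeField idx) j = ((idx j).children.map (treeCoord idx)).prod := rfl

theorem treeCoord_zero (s : RTree) : evalAt 0 (treeCoord idx s) = 0 := by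
  classical
  rw [treeCoord, map_sum]
  refine Finset.sum_eq_zero fun i _ => ?_
  split_ifs
  · rfl
  · exact map_zero _

open Classical in
theorem partialDeriv_treeCoord (i : Fin N) (s : RTree) :
    partialDeriv i (treeCoord idx s) = if idx i = s then 1 else 0 := by
  rw [treeCoord, map_sum, Finset.sum_eq_single i]
  · split_ifs
    · rw [partialDeriv_component_id, Pi.single_eq_same, map_one]
    · exact map_zero _
  · intro j _ hj
    split_ifs
    · rw [partialDeriv_component_id, Pi.single_eq_of_ne hj, map_zero]
    · exact map_zero _
  · intro h
    exact absurd (Finset.mem_univ i) h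

-- Differentiating a monomial at the origin detects exactly that monomial. The factorials of
-- multiplicities and the scalings of the directions assemble into the symmetry coefficient.
open Classical in
theorem realJet_prod_treeCoord (hidx : Function.Injective idx) (us : List RTree)
    (S : Multiset RTree) (hS : ∀ s ∈ S, ∃ i, idx i = s) :
    realJet 0 (us.map fun u i => if idx i = u then (u.symmetryFactor : ℝ) else 0)
        (S.map (treeCoord idx)).prod =
      if (us : Multiset RTree) = S then ((RTree.node us).symmetryFactor : ℝ) else 0 := by
  induction us generalizing S with
  | nil =>
    rw [List.map_nil, realJet_nil, ← evalAt_apply, map_multiset_prod, Multiset.map_map]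
    by_cases h : S = 0
    · subst h
      simp [RTree.symmetryFactor_node]
    · obtain ⟨s, hs⟩ := Multiset.exists_mem_of_ne_zero h
      rw [Multiset.coe_nil, if_neg (Ne.symm h)]
      exact Multiset.prod_eq_zero (Multiset.mem_map.2 ⟨s, hs, treeCoord_zero idx s⟩)
  | cons u us ih =>
    have hD : ∀ i, partialDeriv i (S.map (treeCoord idx)).prod =
        (S.count (idx i) : ℝ) • ((S.erase (idx i)).map (treeCoord idx)).prod := by
      intro i
      rw [derivation_multiset_prod]
      simp only [partialDeriv_treeCoord, ite_mul, one_mul, zero_mul]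
      rw [Finset.sum_multiset_map_count]
      simp only [smul_ite, smul_zero]
      rw [Finset.sum_ite_eq, Nat.cast_smul_eq_nsmul]
      split_ifs with h
      · rfl
      · rw [Multiset.mem_toFinset] at h
        rw [Multiset.count_eq_zero_of_notMem h, zero_smul]
    have hsmul : ∀ (ws : List (Fin N → ℝ)) (c : ℝ) (g : smoothAlgebra N),
        realJet 0 ws (c • g) = c * realJet 0 ws g := fun ws c g => by
      rw [realJet, map_smul, smul_eq_mul, realJet]
    rw [List.map_cons, realJet_cons]
    simp only [hD, hsmul]
    by_cases hu : u ∈ S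
    · obtain ⟨i, rfl⟩ := hS u hu
      obtain ⟨S', rfl⟩ := Multiset.exists_cons_of_mem hu
      rw [Finset.sum_eq_single i]
      · rw [if_pos rfl, Multiset.erase_cons_head,
          ih S' fun s hs => hS s (Multiset.mem_cons_of_mem hs), Multiset.count_cons_self,
          ← Multiset.cons_coe, symmetryFactor_cons]
        by_cases h : (us : Multiset RTree) = S'
        · rw [if_pos h, if_pos (by rw [h]), h]
          push_cast
          ring
        · rw [if_neg h, if_neg (fun h' => h ((Multiset.cons_inj_right _).1 h'))]
          ring
      · intro j _ hj
        rw [if_neg (fun h => hj (hidx h)), zero_mul]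
      · intro h
        exact absurd (Finset.mem_univ i) h
    · rw [if_neg (fun h => hu (by rw [← h]; simp))]
      refine Finset.sum_eq_zero fun i _ => ?_
      split_ifs with h
      · rw [h, Multiset.count_eq_zero_of_notMem hu]
        simp
      · rw [zero_mul]

-- By induction the subtrees give scaled basis vectors, and the monomial in component `j` detects
-- only the children of `idx j`. The index set must be closed under taking children for that
-- monomial to involve genuine coordinates.
open Classical in
theorem elementaryDifferential_treeField (hidx : Function.Injective idx)
    (hchild : ∀ j, ∀ s ∈ (idx j).children, ∃ i, idx i = s) (t : RTree) (j : Fin N) :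
    elementaryDifferential (treeField idx).1 t 0 j =
      if idx j = t then (t.symmetryFactor : ℝ) else 0 := by
  induction t using RTree.ind generalizing j with
  | h s ih =>
    obtain ⟨us, rfl⟩ := Quot.exists_rep s
    change ∀ t ∈ (us : Multiset RTree), _ at ih
    change elementaryDifferential (treeField idx).1 (RTree.node (us : Multiset RTree)) 0 j =
      if idx j = RTree.node (us : Multiset RTree) then
        ((RTree.node (us : Multiset RTree)).symmetryFactor : ℝ) else 0
    have hmap : us.map (fun t => elementaryDifferential (treeField idx).1 t 0) =
        us.map fun u i => if idx i = u then (u.symmetryFactor : ℝ) else 0 :=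
      List.map_congr_left fun u hu => funext fun i => ih u hu i
    rw [elementaryDifferential_eq_jet, component_treeField, hmap]
    refine (realJet_prod_treeCoord idx hidx us _ (hchild j)).trans ?_
    have : (us : Multiset RTree) = (idx j).children ↔ idx j = RTree.node us := by
      constructor
      · intro h; rw [h, RTree.node_children]
      · intro h; rw [h, RTree.children_node]
    simp only [this]

end Separation

/-- A character is determined by its B-series method. -/
theorem bSeries_injective : Function.Injective bSeries := by
  classical
  intro φ ψ h
  refine algHom_ext_tree fun t => ?_
  let e := (treesLE t.order).equivFin
  let idx : Fin (treesLE t.order).card → RTree := fun i => (e.symm i).1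
  have hidx : Function.Injective idx := Subtype.val_injective.comp e.symm.injective
  have hsurj : ∀ s, s.order ≤ t.order → ∃ i, idx i = s := fun s hs =>
    ⟨e ⟨s, mem_treesLE.2 hs⟩, by simp [idx]⟩
  have hchild : ∀ j, ∀ s ∈ (idx j).children, ∃ i, idx i = s := by
    intro j s hs
    refine hsurj s ?_
    have h1 : (idx j).order ≤ t.order := mem_treesLE.1 (e.symm j).2
    rw [← RTree.node_children (idx j), RTree.order_node] at h1
    have h2 : s.order ≤ ((idx j).children.map RTree.order).sum :=
      Multiset.single_le_sum (fun _ _ => Nat.zero_le _) _ (Multiset.mem_map_of_mem _ hs)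
    omega
  obtain ⟨j, hj⟩ := hsurj t le_rfl
  have key : ∀ χ : Character,
      bSeries χ _ (treeField idx) t.order 0 j = χ (tree t) := by
    intro χ
    rw [bSeries, if_neg (RTree.order_pos t).ne', Finset.sum_apply, Finset.sum_eq_single t]
    · rw [Pi.smul_apply, elementaryDifferential_treeField idx hidx hchild, if_pos hj, smul_eq_mul,
        div_mul_cancel₀ _ (by exact_mod_cast (symmetryFactor_pos t).ne')]
    · intro u _ hu
      rw [Pi.smul_apply, elementaryDifferential_treeField idx hidx hchild,
        if_neg (fun h' => hu (h'.symm.trans hj)), smul_zero]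
    · intro h'
      exact absurd (RTree.mem_ofOrder.2 rfl) h'
  rw [← key φ, ← key ψ, h]

/-! ### Adjoint methods -/

theorem substCoeff_zero (g : (Fin N → ℝ) → (Fin N → ℝ)) (Ψ : FormalMap N)
    (y : Fin N → ℝ) : FormalMap.substCoeff g Ψ 0 y = g (Ψ 0 y) := by
  have : ∀ (k : ℕ) (v : Fin k → (Fin N → ℝ)), k = 0 →
      ((k.factorial : ℝ)⁻¹) • iteratedFDeriv ℝ k g (Ψ 0 y) v = g (Ψ 0 y) := by
    rintro k v rfl
    simp
  rw [FormalMap.substCoeff, Finset.sum_congr rfl fun c _ => this _ _ (Nat.le_zero.1 c.length_le)]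
  simp [composition_card]

/-- The coefficient of `hⁿ` is `Φ n y` plus terms that involve only lower coefficients of `Φ`. No
smoothness of the coefficients is needed, as those terms are equal by induction. -/
theorem comp_right_cancel {Φ Φ' Ψ : FormalMap N} (hΨ : ∀ y, Ψ 0 y = y)
    (h : Φ.comp Ψ = Φ'.comp Ψ) : Φ = Φ' := by
  funext n
  induction n using Nat.strong_induction_on with
  | _ n ih =>
    funext y
    have hn := congrFun (congrFun h n) y
    have hmem : (n, 0) ∈ Finset.HasAntidiagonal.antidiagonal n := by simp
    rw [FormalMap.comp, FormalMap.comp, ← Finset.add_sum_erase _ _ hmem,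
      ← Finset.add_sum_erase _ _ hmem] at hn
    have hrest : ∑ p ∈ (Finset.HasAntidiagonal.antidiagonal n).erase (n, 0),
        FormalMap.substCoeff (Φ p.1) Ψ p.2 y =
        ∑ p ∈ (Finset.HasAntidiagonal.antidiagonal n).erase (n, 0),
        FormalMap.substCoeff (Φ' p.1) Ψ p.2 y := by
      refine Finset.sum_congr rfl fun p hp => ?_
      obtain ⟨hne, hp⟩ := Finset.mem_erase.1 hp
      rw [Finset.HasAntidiagonal.mem_antidiagonal] at hp
      rw [ih p.1 (lt_of_le_of_ne (by omega) fun h' => hne (Prod.ext h' (by omega)))]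
    rw [hrest, substCoeff_zero, substCoeff_zero, hΨ] at hn
    exact add_right_cancel hn

theorem bSeries_zero (φ : Character) (f : SmoothField N) (y : Fin N → ℝ) :
    bSeries φ N f 0 y = y := by
  simp [bSeries]

theorem neg_bSeries (ψ : Character) (f : SmoothField N) :
    (bSeries ψ N f).neg = bSeries (bar ψ) N f := by
  funext n y
  by_cases hn : n = 0
  · subst hn
    simp [FormalMap.neg, bSeries]
  · rw [FormalMap.neg, bSeries, bSeries, if_neg hn, if_neg hn, Finset.smul_sum]
    refine Finset.sum_congr rfl fun t ht => ?_
    rw [bar_tree, RTree.mem_ofOrder.1 ht, smul_smul, mul_div_assoc]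

theorem bSeries_counit (f : SmoothField N) : bSeries counit N f = FormalMap.id := by
  funext n y
  by_cases hn : n = 0
  · simp [FormalMap.id, bSeries, hn]
  · simp [FormalMap.id, bSeries, hn, counit, tree]

theorem isAdjoint_bSeries_iff (ψ ψ' : Character) :
    IsAdjoint (bSeries ψ) (bSeries ψ') ↔
      conv (bar ψ) ψ' = counit ∧ conv ψ' (bar ψ) = counit := by
  constructor
  · intro h
    refine ⟨bSeries_injective (funext fun N => funext fun f => ?_),
      bSeries_injective (funext fun N => funext fun f => ?_)⟩
    · rw [← bSeries_comp, ← neg_bSeries, (h N f).1, bSeries_counit]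
    · rw [← bSeries_comp, ← neg_bSeries, (h N f).2, bSeries_counit]
  · intro h N f
    rw [neg_bSeries, bSeries_comp, bSeries_comp, h.1, h.2, bSeries_counit]
    exact ⟨rfl, rfl⟩

theorem isAdjoint_bSeries_bar_antipode (ψ : Character) :
    IsAdjoint (bSeries ψ) (bSeries (bar (ψ.comp antipode))) := by
  rw [isAdjoint_bSeries_iff, ← bar_comp_antipode]
  exact ⟨conv_antipode_right _, conv_antipode_left _⟩

theorem eq_of_isAdjoint_bSeries {ψ ψ' : Character}
    (h : IsAdjoint (bSeries ψ) (bSeries ψ')) : ψ' = bar (ψ.comp antipode) := by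
  rw [← bar_comp_antipode]
  exact eq_of_conv_eq_counit ((isAdjoint_bSeries_iff ψ ψ').1 h).2

/-- The competitors need not be B-series, so the group of characters is of no use here and
cancellation of formal maps takes its place. -/
theorem isAdjoint_bSeries_unique {ψ : Character} {Φ Φ' : Method}
    (h : IsAdjoint (bSeries ψ) Φ) (h' : IsAdjoint (bSeries ψ) Φ') : Φ = Φ' := by
  funext N f
  refine comp_right_cancel (fun y => ?_) ((h N f).1.trans (h' N f).1.symm)
  rw [neg_bSeries, bSeries_zero]

end BCK

end

theorem mainTheorem4 (ψ : BCK.Character) :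
    -- the adjoint method of the B-series method of `ψ` exists, is unique, and is a B-series method
    (∃! Φ : BCK.Method, BCK.IsAdjoint (BCK.bSeries ψ) Φ) ∧
    (∃ ψ' : BCK.Character, BCK.IsAdjoint (BCK.bSeries ψ) (BCK.bSeries ψ')) ∧
    -- its character on trees and, more generally, on all of `H`
    (∀ ψ' : BCK.Character, BCK.IsAdjoint (BCK.bSeries ψ) (BCK.bSeries ψ') →
      (∀ τ : BCK.RTree,
        ψ' (BCK.tree τ) = (-1 : ℝ) ^ τ.order * ψ (BCK.antipode (BCK.tree τ))) ∧
      ψ' = BCK.bar (ψ.comp BCK.antipode)) ∧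
    -- symmetric methods
    (BCK.IsSymmetric (BCK.bSeries ψ) ↔ BCK.IsOdd ψ) ∧
    (BCK.IsSymmetric (BCK.bSeries ψ) ↔
      ∀ τ : BCK.RTree,
        ψ (BCK.tree τ) = (-1 : ℝ) ^ τ.order * ψ (BCK.antipode (BCK.tree τ))) := by
  have hbar : ∀ τ : BCK.RTree, BCK.bar (ψ.comp BCK.antipode) (BCK.tree τ) =
      (-1 : ℝ) ^ τ.order * ψ (BCK.antipode (BCK.tree τ)) := fun τ => BCK.bar_tree _ τ
  have hadj := BCK.isAdjoint_bSeries_bar_antipode ψ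
  refine ⟨⟨_, hadj, fun Φ hΦ => BCK.isAdjoint_bSeries_unique hΦ hadj⟩, ⟨_, hadj⟩, ?_, ?_, ?_⟩
  · intro ψ' h
    have h' := BCK.eq_of_isAdjoint_bSeries h
    exact ⟨fun τ => by rw [h', hbar], h'⟩
  · exact BCK.isAdjoint_bSeries_iff ψ ψ
  · constructor
    · intro h τ
      rw [← hbar, ← BCK.eq_of_isAdjoint_bSeries h]
    · intro h
      have h' : ψ = BCK.bar (ψ.comp BCK.antipode) :=
        BCK.algHom_ext_tree fun τ => by rw [hbar, ← h]
      rw [← h'] at hadj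
      exact hadj
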